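/- Let $\Sigma$ be a finite alphabet. A (Mealy-type) probabilistic finite automaton (PFA) $X=(R,W,\mu_R,\mu_W,\sigma)$ over $\Sigma$ consists of non-empty finite sets $R$ (input states) and $W$ (output states), transition probabilities $\mu_R:R\times\Sigma\times(R\cup W)\to[0,1]$ with $\sum_{p}\mu_R(q,a,p)=1$ for all $q\in R$, $a\in\Sigma$, and $\mu_W:W\times\Sigma\times(R\cup W)\to[0,1]$ with $\sum_{a\in\Sigma}\sum_{p}\mu_W(q,a,p)=1$ for all $q\in W$, and an initial distribution $\sigma$ on $R\cup W$. In an input state $q$ it reads the next input symbol $a$ and moves to $p$ with probability $\mu_R(q,a,p)$; in an output state $q$, with probability $\mu_W(q,a,p)$, it writes $a$ and moves to $p$. The output $X(t)$ on an infinite string $t\in\Sigma^\omega$ is the random finite or infinite string of all symbols written. For $n\in\mathbb N$ the smoothed trie height is $$H(\Sigma^\omega,n,X)=\sup_{A\subseteq\Sigma^\omega,\ |A|=n}\ \mathbb E\Bigl[\max_{s,t\in A,\ s\ne t}\mathrm{lcp}(X(s),X(t))\Bigr],$$ where $\mathrm{lcp}$ is the length of the longest common prefix and the strings of $A$ are perturbed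 independently. **Theorem.** Let $X$ be a star-like PFA in canonical form, i.e. $R=\{s\}$, $\mu_W(q,a,q')=0$ for all $q\neq q'$ in $W$ and $a\in\Sigma$, $\sum_{a}\mu_W(q,a,q)<1$ for all $q\in W$, and $\sigma(s)=1$. Put $p_a=\mu_R(s,a,s)$, $\rho_{a,q}=\mu_R(s,a,q)$ and $\eta_q=\sum_{a\in\Sigma}\mu_W(q,a,s)$. Suppose that $p_a<1$ for all $a\in\Sigma$ and that $$p_a+\sum_{q\in W}\rho_{a,q}\bigl(\mu_W(q,b,q)+\mu_W(q,b,s)\bigr)<1\qquad\text{for all }a,b\in\Sigma,$$ and let $\delta$ be the maximum of the left-hand side over $a,b\in\Sigma$. Then the rational function $$\tilde{\mathcal Z}_X(z)=\prod_{a\in\Sigma}\Bigl(1-\delta p_a-\sum_{q\in W}\frac{\delta\,\rho_{a,q}\,\eta_q\,z}{1-(1-\eta_q)z}\Bigr)^{-1}$$ has a unique pole $\tilde z$ of minimum modulus in $\mathbb C$, it is real, and $\tilde z>1$. With $\gamma=1/\tilde z$, there is $N$ such that for every $\varepsilon>0$ there is a function $f:\mathbb N\to\mathbb R$ with $f(n)\to0$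 as $n\to\infty$ such that, for all $n\ge N$, the quantity $H(\Sigma^\omega,n,X)$ is finite and $$H(\Sigma^\omega,n,X)\le 2\,\bigl\lceil(1+\varepsilon)\log_{1/\gamma}n\bigr\rceil+f(n).$$ -/

import Mathlib

open MeasureTheory ProbabilityTheory Filter Topology
open scoped ENNReal

/-! ### Finite and infinite strings

Infinite strings over `α` are functions `ℕ → α` (the first symbol has index `0`), finite strings are
lists, and finite-or-infinite strings are `Stream'.Seq α`. -/

/-- The product σ-algebra on the set of finite and infinite strings: the one generated by the
coordinates. -/
instance strMeasurableSpace (α : Type*) : MeasurableSpace (Stream'.Seq α) :=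
  ⨆ n : ℕ, MeasurableSpace.comap (fun x : Stream'.Seq α => x.get? n) ⊤

/-- The finite string `u` is a prefix of the finite or infinite string `x`. -/
def IsStrPrefix {α : Type*} (u : List α) (x : Stream'.Seq α) : Prop :=
  ∀ i < u.length, x.get? i = u[i]?

/-- The length of the longest common prefix of two finite or infinite strings. -/
noncomputable def lcp {α : Type*} (x y : Stream'.Seq α) : ℕ∞ :=
  ⨆ (u : List α) (_ : IsStrPrefix u x ∧ IsStrPrefix u y), (u.length : ℕ∞)

/-! ### Smoothed trie height -/

/-- A string perturbation function on infinite inputs: each infinite string is mapped to the law of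
its random image, which is a finite or infinite string. -/
abbrev StringPerturbation (α : Type*) : Type _ :=
  (ℕ → α) → ProbabilityMeasure (Stream'.Seq α)

/-- The smoothed trie height `H(S, n, X)`: the supremum, over all sets `A ⊆ S` of `n` strings, of
the expected maximum of `lcp (X s) (X t)` over pairs of distinct `s, t ∈ A`, where the strings of
`A` are perturbed independently. -/
noncomputable def smoothedTrieHeight {α : Type*} (S : Set (ℕ → α)) (n : ℕ)
    (X : StringPerturbation α) : ℝ≥0∞ :=
  ⨆ (A : Finset (ℕ → α)) (_ : (A : Set (ℕ → α)) ⊆ S ∧ A.card = n),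
    ∫⁻ x : A → Stream'.Seq α,
      (⨆ (s : A) (t : A) (_ : s ≠ t), ((lcp (x s) (x t) : ℕ∞) : ℝ≥0∞))
      ∂(Measure.pi fun s : A => (X (s : ℕ → α) : Measure (Stream'.Seq α)))

/-! ### Probabilistic finite automata -/

/-- A (Mealy-type) probabilistic finite automaton over the alphabet `α` with input states `R` and
output states `W`. -/
structure PFA (α R W : Type*) [Fintype α] [Fintype R] [Fintype W] where
  nonempty_R : Nonempty R
  nonempty_W : Nonempty W
  /-- in input state `q`, if the symbol `a` is read, move to `p` with probability `μR q a p` -/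
  μR : R → α → R ⊕ W → ℝ
  μR_nonneg : ∀ q a p, 0 ≤ μR q a p
  μR_sum : ∀ q a, ∑ p, μR q a p = 1
  /-- in output state `q`, with probability `μW q a p` write the symbol `a` and move to `p` -/
  μW : W → α → R ⊕ W → ℝ
  μW_nonneg : ∀ q a p, 0 ≤ μW q a p
  μW_sum : ∀ q, ∑ a, ∑ p, μW q a p = 1
  /-- the initial distribution -/
  σ : R ⊕ W → ℝ
  σ_nonneg : ∀ q, 0 ≤ σ q
  σ_sum : ∑ q, σ q = 1

/-- The probability mass function on a finite type with given nonnegative real weights. -/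
noncomputable def pmfOfReal {β : Type*} [Fintype β] (f : β → ℝ) (h0 : ∀ b, 0 ≤ f b)
    (h1 : ∑ b, f b = 1) : PMF β :=
  PMF.ofFintype (fun b => ENNReal.ofReal (f b)) (by
    rw [← ENNReal.ofReal_sum_of_nonneg fun b _ => h0 b, h1, ENNReal.ofReal_one])

/-- A configuration of a PFA running on an input string: the current state, the number of input
symbols read so far, and the output written so far. -/
structure PFAConfig (α R W : Type*) where
  state : R ⊕ W
  read : ℕ
  out : List α

instance pfaConfigMeasurableSpace (α R W : Type*) : MeasurableSpace (PFAConfig α R W) := ⊤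

/-- The output of an infinite run, i.e. of a sequence of configurations: its symbol at position `n`
is the symbol at position `n` of the output written so far, at the first time when this has more
than `n` symbols; the output string has length at most `n` if that never happens. -/
noncomputable def runOutput {α R W : Type*} (ω : ℕ → PFAConfig α R W) : Stream'.Seq α := by
  classical
  exact ⟨fun n => if h : ∃ k, n < (ω k).out.length then (ω (Nat.find h)).out[n]? else none, by
    intro n hn
    have h : ¬ ∃ k, n < (ω k).out.length := by
      intro h
      simp only [dif_pos h] at hn
      exact absurd (List.getElem?_eq_none_iff.mp hn) (not_le.mpr (Nat.find_spec h))
    have h' : ¬ ∃ k, n + 1 < (ω k).out.length := fun ⟨k, hk⟩ => h ⟨k, by omega⟩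
    simp only [dif_neg h']⟩

theorem measurable_runOutput {α R W : Type*} :
    Measurable (runOutput : (ℕ → PFAConfig α R W) → Stream'.Seq α) := by
  classical
  rw [strMeasurableSpace, measurable_iff_comap_le, MeasurableSpace.comap_iSup]
  refine iSup_le fun n => ?_
  rw [MeasurableSpace.comap_comp, ← measurable_iff_comap_le]
  intro T _
  have key : ((fun x : Stream'.Seq α => x.get? n) ∘
        (runOutput : (ℕ → PFAConfig α R W) → Stream'.Seq α)) ⁻¹' T =
      (⋃ k, (⋂ j ∈ Set.Iio k, (fun ω : ℕ → PFAConfig α R W => ω j) ⁻¹'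
          {c | ¬ n < c.out.length}) ∩ (fun ω : ℕ → PFAConfig α R W => ω k) ⁻¹'
          {c | n < c.out.length ∧ c.out[n]? ∈ T}) ∪
      ((⋂ k, (fun ω : ℕ → PFAConfig α R W => ω k) ⁻¹' {c | ¬ n < c.out.length}) ∩
        {_ω | (none : Option α) ∈ T}) := by
    ext ω
    have hval : (runOutput ω).get? n =
        if h : ∃ k, n < (ω k).out.length then (ω (Nat.find h)).out[n]? else none := by
      simp only [runOutput, Stream'.Seq.get?]
    simp only [Set.mem_preimage, Function.comp_apply, hval, Set.mem_union, Set.mem_iUnion,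
      Set.mem_inter_iff, Set.mem_iInter, Set.mem_Iio, Set.mem_ofPred_eq]
    by_cases h : ∃ k, n < (ω k).out.length
    · rw [dif_pos h]
      constructor
      · intro hT
        exact Or.inl ⟨Nat.find h, fun j hj => Nat.find_min h hj, Nat.find_spec h, hT⟩
      · rintro (⟨k, hmin, hk, hT⟩ | ⟨hno, -⟩)
        · have : Nat.find h = k := (Nat.find_eq_iff h).mpr ⟨hk, fun j hj => hmin j hj⟩
          rw [this]
          exact hT
        · obtain ⟨k, hk⟩ := h
          exact absurd hk (hno k)
    · rw [dif_neg h]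
      push Not at h
      constructor
      · intro hT
        exact Or.inr ⟨fun k => not_lt.mpr (h k), hT⟩
      · rintro (⟨k, -, hk, -⟩ | ⟨-, hT⟩)
        · exact absurd hk (not_lt.mpr (h k))
        · exact hT
  rw [key]
  have hm : ∀ (k : ℕ) (U : Set (PFAConfig α R W)),
      MeasurableSet ((fun ω : ℕ → PFAConfig α R W => ω k) ⁻¹' U) :=
    fun k U => measurable_pi_apply k (MeasurableSpace.measurableSet_top (s := U))
  refine MeasurableSet.union (MeasurableSet.iUnion fun k => MeasurableSet.inter ?_ (hm _ _))
    (MeasurableSet.inter (MeasurableSet.iInter fun k => hm _ _) (MeasurableSet.const _))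
  exact MeasurableSet.biInter (Set.to_countable _) fun j _ => hm _ _

namespace PFA

variable {α R W : Type*} [Fintype α] [Fintype R] [Fintype W]

/-- The random initial configuration: the state is drawn from the initial distribution, nothing has
been read or written. -/
noncomputable def initial (X : PFA α R W) : PMF (PFAConfig α R W) :=
  (pmfOfReal X.σ X.σ_nonneg X.σ_sum).map fun p => ⟨p, 0, []⟩

/-- One step of the automaton on the infinite input string `t`: in an input state the next symbol
of `t` is read, in an output state a symbol is written. -/
noncomputable def step (X : PFA α R W) (t : ℕ → α) : PFAConfig α R W → PMF (PFAConfig α R W)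
  | ⟨Sum.inl q, i, u⟩ =>
      (pmfOfReal (X.μR q (t i)) (X.μR_nonneg q (t i)) (X.μR_sum q (t i))).map
        fun p => ⟨p, i + 1, u⟩
  | ⟨Sum.inr q, i, u⟩ =>
      (pmfOfReal (fun ap : α × (R ⊕ W) => X.μW q ap.1 ap.2) (fun ap => X.μW_nonneg q ap.1 ap.2)
        ((Fintype.sum_prod_type _).trans (X.μW_sum q))).map
        fun ap => ⟨ap.2, i, u ++ [ap.1]⟩

/-- The Markov kernel of the steps of the automaton on the infinite input string `t`. -/
noncomputable def stepKernel (X : PFA α R W) (t : ℕ → α) :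
    Kernel (PFAConfig α R W) (PFAConfig α R W) where
  toFun c := (X.step t c).toMeasure
  measurable' := measurable_from_top

instance isMarkovKernel_stepKernel (X : PFA α R W) (t : ℕ → α) :
    IsMarkovKernel (X.stepKernel t) :=
  ⟨fun c => inferInstanceAs (IsProbabilityMeasure (X.step t c).toMeasure)⟩

/-- The law of the run of the automaton on the infinite input string `t`: the Markov chain of
configurations given by the initial distribution and the step kernel. -/
noncomputable def runMeasure (X : PFA α R W) (t : ℕ → α) : Measure (ℕ → PFAConfig α R W) :=
  Kernel.trajMeasure (X := fun _ : ℕ => PFAConfig α R W) X.initial.toMeasure fun k =>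
    (X.stepKernel t).comap
      (fun h : (Π _ : Finset.Iic k, PFAConfig α R W) => h ⟨k, Finset.mem_Iic.mpr le_rfl⟩)
      (measurable_pi_apply _)

instance isProbabilityMeasure_runMeasure (X : PFA α R W) (t : ℕ → α) :
    IsProbabilityMeasure (X.runMeasure t) := by
  unfold runMeasure
  infer_instance

/-- The string perturbation function represented by the automaton: an infinite input string is
mapped to the law of the output of the run on it. -/
noncomputable def perturbation (X : PFA α R W) : StringPerturbation α := fun t =>
  ⟨(X.runMeasure t).map runOutput,
    Measure.isProbabilityMeasure_map measurable_runOutput.aemeasurable⟩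

/-- The automaton is star-like: there is exactly one input state, no transition leads from an output
state to a different output state, and the probability to loop at an output state is less than
one. -/
structure IsStarLike (X : PFA α R W) : Prop where
  card_R : Fintype.card R = 1
  no_cross : ∀ q q' : W, q ≠ q' → ∀ a : α, X.μW q a (Sum.inr q') = 0
  loop_lt_one : ∀ q : W, ∑ a, X.μW q a (Sum.inr q) < 1

/-- The automaton is in canonical form with respect to the input state `s`: runs start in `s`. -/
def IsCanonical (X : PFA α R W) (s : R) : Prop :=
  X.σ (Sum.inl s) = 1 ∧ ∀ q : W, X.σ (Sum.inr q) = 0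

/-- The deletion probability `p_a`. -/
def del (X : PFA α R W) (s : R) (a : α) : ℝ := X.μR s a (Sum.inl s)

/-- The probability `ρ_{a,q}` to move from `s` to the output state `q` when `a` is read. -/
def rho (X : PFA α R W) (s : R) (a : α) (q : W) : ℝ := X.μR s a (Sum.inr q)

/-- The return probability `η_q` from the output state `q`. -/
def eta (X : PFA α R W) (s : R) (q : W) : ℝ := ∑ a, X.μW q a (Sum.inl s)

/-- The left-hand side of the condition on the symbols `a` and `b`. -/
def condTerm (X : PFA α R W) (s : R) (a b : α) : ℝ :=
  X.μR s a (Sum.inl s) +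
    ∑ q : W, X.μR s a (Sum.inr q) * (X.μW q b (Sum.inr q) + X.μW q b (Sum.inl s))

/-- The rational function `Z̃_X` of a complex variable, with parameter `δ`. -/
noncomputable def genFun (X : PFA α R W) (s : R) (δ : ℝ) (z : ℂ) : ℂ :=
  ∏ a : α, (1 - (δ : ℂ) * (X.del s a : ℂ) -
    ∑ q : W, (δ : ℂ) * (X.rho s a q : ℂ) * (X.eta s q : ℂ) * z /
      (1 - (1 - (X.eta s q : ℂ)) * z))⁻¹

end PFA

/-- `z` is a pole of the meromorphic function `f`. -/
def IsPole (f : ℂ → ℂ) (z : ℂ) : Prop :=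
  MeromorphicAt f z ∧ meromorphicOrderAt f z < 0

/-! Let P_t(u) be the probability that the output on t has prefix u. Independent outputs on s and t
share k symbols with probability Σ P_s(u) P_t(u) over words u of length k. By the
arithmetic-geometric mean inequality this is at most the average of Σ P_s(u)² and Σ P_t(u)², so it
suffices to bound this energy for a single input string (`PFA.measure_le_lcp_le`).

Energies decay like x^{-k} (`PFA.IsStarLike.wordSum_prefixProb_sq_le`). After a is read in `s`, the
probability of a prefix starting with b is a combination over deletion and over pairs (output state,
state after writing b), of total weight `condTerm` ≤ δ. Cauchy–Schwarz therefore yields a factor δ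
for the squares. Summing over words gives a renewal inequality with supersolution x^{-k} at `s` and
y_q x^{-k} at q, where y_q = η_q x / (1 - (1 - η_q) x), as soon as F_a(x) = δ (p_a + Σ ρ_{a,q} y_q)
≤ 1 for every a; F_a is `PFA.symbolGenFun`.

The denominator of `genFun` is the product of the 1 - F_a. Each F_a is increasing with F_a(1) = δ <
1, and the pole is the least root of the equations F_a = 1
(`PFA.IsStarLike.exists_min_symbolGenFun_eq_one`). On the closed disc up to that root z, the real
part of F_a stays below 1 except at z itself (`PFA.IsStarLike.genFunFactor_ne_zero`).

Finally, a union bound over n² pairs and a geometric tail beyond K = 2⌈(1+ε) log_z n⌉ leave an error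
of order n² z^{-K} ≤ n^{-2ε}. -/

/-! ### Sums over words of fixed length -/

/-- The sum of `g u` over all words `u` of length `k`. -/
noncomputable def wordSum {α : Type*} [Fintype α] : ℕ → (List α → ℝ) → ℝ
  | 0, g => g []
  | k + 1, g => ∑ b, wordSum k fun u => g (b :: u)

section wordSum

variable {α : Type*} [Fintype α]

theorem wordSum_mono (k : ℕ) {f g : List α → ℝ} (h : ∀ u, f u ≤ g u) :
    wordSum k f ≤ wordSum k g := by
  induction k generalizing f g with
  | zero => exact h []
  | succ k ih => exact Finset.sum_le_sum fun b _ => ih fun u => h _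

theorem wordSum_nonneg (k : ℕ) {g : List α → ℝ} (h : ∀ u, 0 ≤ g u) : 0 ≤ wordSum k g := by
  induction k generalizing g with
  | zero => exact h []
  | succ k ih => exact Finset.sum_nonneg fun b _ => ih fun u => h _

theorem wordSum_add (k : ℕ) (f g : List α → ℝ) :
    wordSum k (fun u => f u + g u) = wordSum k f + wordSum k g := by
  induction k generalizing f g with
  | zero => rfl
  | succ k ih => simp only [wordSum, ih, Finset.sum_add_distrib]

theorem wordSum_const_mul (k : ℕ) (c : ℝ) (g : List α → ℝ) :
    wordSum k (fun u => c * g u) = c * wordSum k g := by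
  induction k generalizing g with
  | zero => rfl
  | succ k ih => simp only [wordSum, ih, Finset.mul_sum]

theorem wordSum_sum (k : ℕ) {ι : Type*} (s : Finset ι) (f : ι → List α → ℝ) :
    wordSum k (fun u => ∑ i ∈ s, f i u) = ∑ i ∈ s, wordSum k (f i) := by
  induction k generalizing f with
  | zero => rfl
  | succ k ih => simp only [wordSum, ih]; exact Finset.sum_comm

theorem tendsto_wordSum (k : ℕ) {f : ℕ → List α → ℝ} {g : List α → ℝ}
    (h : ∀ u, Tendsto (fun n => f n u) atTop (𝓝 (g u))) :
    Tendsto (fun n => wordSum k (f n)) atTop (𝓝 (wordSum k g)) := by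
  induction k generalizing f g with
  | zero => exact h []
  | succ k ih => exact tendsto_finsetSum _ fun b _ => ih fun u => h _

end wordSum

/-! ### Prefix probabilities and the decay of their squares -/

/-- Cauchy–Schwarz for the weights c, which need not sum to one: the total weight survives as a
factor, and this is the source of δ. -/
theorem sum_mul_sq_le_sum_mul_sum_mul_sq {ι : Type*} (s : Finset ι) {c : ι → ℝ} (x : ι → ℝ)
    (hc : ∀ i, 0 ≤ c i) :
    (∑ i ∈ s, c i * x i) ^ 2 ≤ (∑ i ∈ s, c i) * ∑ i ∈ s, c i * x i ^ 2 :=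
  Finset.sum_sq_le_sum_mul_sum_of_sq_le_mul s (fun i _ => hc i)
    (fun i _ => mul_nonneg (hc i) (sq_nonneg _)) fun i _ => le_of_eq (by ring)

namespace PFA

variable {α R W : Type*} [Fintype α] [Fintype R] [Fintype W]

/-- The probability that, within `n` steps from the state `p` with `i` input symbols read, the
automaton writes a string with prefix `v`. -/
noncomputable def prefixProb (X : PFA α R W) (t : ℕ → α) : ℕ → R ⊕ W → ℕ → List α → ℝ
  | 0, _, _, [] => 1
  | 0, _, _, _ :: _ => 0
  | n + 1, Sum.inl q, i, v => ∑ p, X.μR q (t i) p * prefixProb X t n p (i + 1) v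
  | _ + 1, Sum.inr _, _, [] => 1
  | n + 1, Sum.inr q, i, b :: v => ∑ p, X.μW q b p * prefixProb X t n p i v

variable (X : PFA α R W) (t : ℕ → α)

theorem prefixProb_nil (n : ℕ) (p : R ⊕ W) (i : ℕ) : X.prefixProb t n p i [] = 1 := by
  induction n generalizing p i with
  | zero => rfl
  | succ n ih =>
    cases p with
    | inl q => simp only [prefixProb, ih, mul_one, X.μR_sum]
    | inr q => rfl

theorem prefixProb_nonneg (n : ℕ) (p : R ⊕ W) (i : ℕ) (v : List α) :
    0 ≤ X.prefixProb t n p i v := by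
  induction n generalizing p i v with
  | zero => cases v <;> simp [prefixProb]
  | succ n ih =>
    cases p with
    | inl q => exact Finset.sum_nonneg fun p _ => mul_nonneg (X.μR_nonneg _ _ _) (ih _ _ _)
    | inr q =>
      cases v with
      | nil => simp [prefixProb]
      | cons b v => exact Finset.sum_nonneg fun p _ => mul_nonneg (X.μW_nonneg _ _ _) (ih _ _ _)

theorem sum_μW_le_one (q : W) (b : α) : ∑ p, X.μW q b p ≤ 1 := by
  rw [← X.μW_sum q]
  exact Finset.single_le_sum (f := fun b => ∑ p, X.μW q b p)
    (fun a _ => Finset.sum_nonneg fun _ _ => X.μW_nonneg _ _ _) (Finset.mem_univ b)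

theorem prefixProb_le_one (n : ℕ) (p : R ⊕ W) (i : ℕ) (v : List α) :
    X.prefixProb t n p i v ≤ 1 := by
  induction n generalizing p i v with
  | zero => cases v <;> simp [prefixProb]
  | succ n ih =>
    cases p with
    | inl q =>
      rw [← X.μR_sum q (t i)]
      exact Finset.sum_le_sum fun p _ => mul_le_of_le_one_right (X.μR_nonneg _ _ _) (ih _ _ _)
    | inr q =>
      cases v with
      | nil => simp [prefixProb]
      | cons b v =>
        exact (Finset.sum_le_sum fun p _ =>
          mul_le_of_le_one_right (X.μW_nonneg _ _ _) (ih _ _ _)).trans (X.sum_μW_le_one q b)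

theorem prefixProb_le_succ (n : ℕ) (p : R ⊕ W) (i : ℕ) (v : List α) :
    X.prefixProb t n p i v ≤ X.prefixProb t (n + 1) p i v := by
  induction n generalizing p i v with
  | zero =>
    cases v with
    | nil => rw [prefixProb_nil, prefixProb_nil]
    | cons b v => exact X.prefixProb_nonneg t 1 p i _
  | succ n ih =>
    cases p with
    | inl q =>
      exact Finset.sum_le_sum fun p _ => mul_le_mul_of_nonneg_left (ih _ _ _) (X.μR_nonneg _ _ _)
    | inr q =>
      cases v with
      | nil => rw [prefixProb_nil, prefixProb_nil]
      | cons b v =>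
        exact Finset.sum_le_sum fun p _ =>
          mul_le_mul_of_nonneg_left (ih _ _ _) (X.μW_nonneg _ _ _)

theorem monotone_prefixProb (p : R ⊕ W) (i : ℕ) (v : List α) :
    Monotone fun n => X.prefixProb t n p i v :=
  monotone_nat_of_le_succ fun n => X.prefixProb_le_succ t n p i v

variable {X} {s : R}

theorem IsStarLike.sum_inl (hX : X.IsStarLike) (g : R → ℝ) : ∑ r, g r = g s := by
  obtain ⟨r, hr⟩ := Fintype.card_eq_one_iff.mp hX.card_R
  exact Fintype.sum_eq_single s fun r' h => absurd ((hr r').trans (hr s).symm) h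

theorem IsStarLike.sum_μR (hX : X.IsStarLike) (a : α) (g : R ⊕ W → ℝ) :
    ∑ p, X.μR s a p * g p =
      X.μR s a (Sum.inl s) * g (Sum.inl s) + ∑ q, X.μR s a (Sum.inr q) * g (Sum.inr q) := by
  rw [Fintype.sum_sum_type, hX.sum_inl (s := s)]

theorem IsStarLike.sum_μW (hX : X.IsStarLike) (s : R) (q : W) (b : α) (g : R ⊕ W → ℝ) :
    ∑ p, X.μW q b p * g p =
      X.μW q b (Sum.inl s) * g (Sum.inl s) + X.μW q b (Sum.inr q) * g (Sum.inr q) := by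
  rw [Fintype.sum_sum_type, hX.sum_inl (s := s),
    Fintype.sum_eq_single q fun q' h => by rw [hX.no_cross q q' h.symm, zero_mul]]

theorem IsStarLike.sum_loop (hX : X.IsStarLike) (s : R) (q : W) :
    ∑ b, X.μW q b (Sum.inr q) = 1 - X.eta s q := by
  have h := X.μW_sum q
  have h2 : ∀ b, ∑ p, X.μW q b p = X.μW q b (Sum.inl s) + X.μW q b (Sum.inr q) := fun b => by
    simpa using hX.sum_μW s q b fun _ => 1
  simp only [h2, Finset.sum_add_distrib] at h
  rw [eta]
  linarith

theorem IsStarLike.eta_pos (hX : X.IsStarLike) (s : R) (q : W) : 0 < X.eta s q := by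
  have := hX.sum_loop s q
  have := hX.loop_lt_one q
  linarith

theorem IsStarLike.eta_le_one (hX : X.IsStarLike) (s : R) (q : W) : X.eta s q ≤ 1 := by
  have := hX.sum_loop s q
  have : 0 ≤ ∑ b, X.μW q b (Sum.inr q) := Finset.sum_nonneg fun b _ => X.μW_nonneg _ _ _
  linarith

theorem IsStarLike.del_add_sum_rho (hX : X.IsStarLike) (s : R) (a : α) :
    X.del s a + ∑ q, X.rho s a q = 1 := by
  rw [← X.μR_sum s a]
  simpa [del, rho] using (hX.sum_μR (s := s) a fun _ => 1).symm

/-- Once the written symbol is summed out, an output state of a star-like automaton only returns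
(probability η) or loops (probability 1 - η). -/
theorem IsStarLike.sum_wordSum_μW (hX : X.IsStarLike) (s : R) (q : W) (k : ℕ)
    (g : R ⊕ W → List α → ℝ) :
    ∑ b, wordSum k (fun v => ∑ p, X.μW q b p * g p v) =
      X.eta s q * wordSum k (g (Sum.inl s)) + (1 - X.eta s q) * wordSum k (g (Sum.inr q)) := by
  simp only [hX.sum_μW s, wordSum_add, wordSum_const_mul, Finset.sum_add_distrib,
    ← Finset.sum_mul, hX.sum_loop s, eta]

theorem prefixProb_inr_sq_le (X : PFA α R W) (t : ℕ → α) (n : ℕ) (q : W) (i : ℕ) (b : α)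
    (v : List α) :
    X.prefixProb t (n + 1) (Sum.inr q) i (b :: v) ^ 2 ≤
      ∑ p, X.μW q b p * X.prefixProb t n p i v ^ 2 :=
  (sum_mul_sq_le_sum_mul_sum_mul_sq _ _ fun p => X.μW_nonneg q b p).trans
    (mul_le_of_le_one_left
      (Finset.sum_nonneg fun _ _ => mul_nonneg (X.μW_nonneg _ _ _) (sq_nonneg _))
      (X.sum_μW_le_one q b))

theorem IsStarLike.prefixProb_inl_sq_le (hX : X.IsStarLike) (t : ℕ → α) (n : ℕ) (i : ℕ) (b : α)
    (v : List α) :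
    X.prefixProb t (n + 1) (Sum.inl s) i (b :: v) ^ 2 ≤
      X.condTerm s (t i) b * (X.del s (t i) * X.prefixProb t n (Sum.inl s) (i + 1) (b :: v) ^ 2 +
        ∑ q, X.rho s (t i) q * ∑ p, X.μW q b p * X.prefixProb t n p (i + 1) v ^ 2) := by
  -- `none` stands for deletion of the symbol read; `some (q, p)` for a move to q followed by
  -- writing b and moving to p. The weights sum to `condTerm`.
  let c : Option (W × (R ⊕ W)) → ℝ := fun o =>
    o.elim (X.del s (t i)) fun qp => X.rho s (t i) qp.1 * X.μW qp.1 b qp.2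
  let x : Option (W × (R ⊕ W)) → ℝ := fun o =>
    o.elim (X.prefixProb t n (Sum.inl s) (i + 1) (b :: v)) fun qp =>
      X.prefixProb t n qp.2 (i + 1) v
  have hc : ∀ o, 0 ≤ c o := by
    rintro (_ | ⟨q, p⟩)
    · exact X.μR_nonneg _ _ _
    · exact mul_nonneg (X.μR_nonneg _ _ _) (X.μW_nonneg _ _ _)
  have h1 : ∑ o, c o = X.condTerm s (t i) b := by
    simp only [c, Fintype.sum_option, Fintype.sum_prod_type, Option.elim, ← Finset.mul_sum, condTerm,
      del, rho]
    congr 1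
    refine Finset.sum_congr rfl fun q _ => ?_
    have := hX.sum_μW s q b fun _ => 1
    simp only [mul_one] at this
    rw [this, add_comm]
  have h2 : ∑ o, c o * x o ^ 2 =
      X.del s (t i) * X.prefixProb t n (Sum.inl s) (i + 1) (b :: v) ^ 2 +
        ∑ q, X.rho s (t i) q * ∑ p, X.μW q b p * X.prefixProb t n p (i + 1) v ^ 2 := by
    simp only [c, x, Fintype.sum_option, Fintype.sum_prod_type, Option.elim, Finset.mul_sum,
      mul_assoc]
  have h3 : X.prefixProb t (n + 1) (Sum.inl s) i (b :: v) ≤ ∑ o, c o * x o := by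
    simp only [c, x, Fintype.sum_option, Fintype.sum_prod_type, Option.elim, mul_assoc,
      ← Finset.mul_sum]
    rw [prefixProb, hX.sum_μR]
    refine add_le_add le_rfl (Finset.sum_le_sum fun q _ => ?_)
    -- Reading and then writing costs two steps; granting one extra step brings every branch back to
    -- the same n.
    exact mul_le_mul_of_nonneg_left (X.prefixProb_le_succ t n (Sum.inr q) (i + 1) (b :: v))
      (X.μR_nonneg _ _ _)
  rw [← h1, ← h2]
  exact (pow_le_pow_left₀ (X.prefixProb_nonneg _ _ _ _ _) h3 2).trans
    (sum_mul_sq_le_sum_mul_sum_mul_sq _ _ hc)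

/-- Squared word probabilities decay geometrically at every rate `x` at which the generating
function of each input symbol is at most one. -/
theorem IsStarLike.wordSum_prefixProb_sq_le (hX : X.IsStarLike) (t : ℕ → α) {x δ : ℝ}
    {y : W → ℝ} {good : W → Prop} (hx : 0 < x) (hδ0 : 0 ≤ δ)
    (hδ : ∀ a b, X.condTerm s a b ≤ δ) (hgood : ∀ a q, X.rho s a q ≠ 0 → good q)
    (hy1 : ∀ q, good q → 1 ≤ y q)
    (hy : ∀ q, good q → x * (X.eta s q + (1 - X.eta s q) * y q) ≤ y q)
    (hF : ∀ a, δ * (X.del s a + ∑ q, X.rho s a q * y q) ≤ 1) (n : ℕ) :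
    (∀ i k, wordSum k (fun v => X.prefixProb t n (Sum.inl s) i v ^ 2) ≤ x⁻¹ ^ k) ∧
    ∀ q, good q → ∀ i k, wordSum k (fun v => X.prefixProb t n (Sum.inr q) i v ^ 2) ≤
      y q * x⁻¹ ^ k := by
  have hx' : 0 < x⁻¹ := inv_pos.mpr hx
  -- Writing one symbol shortens the remaining word by one; the inequality `hy` for y absorbs the
  -- resulting factor x.
  have hmix : ∀ q, good q → ∀ {A B : ℝ} {k : ℕ}, A ≤ x⁻¹ ^ k → B ≤ y q * x⁻¹ ^ k →
      X.eta s q * A + (1 - X.eta s q) * B ≤ y q * x⁻¹ ^ (k + 1) := by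
    intro q hq A B k hA hB
    have h0 := hX.eta_pos s q
    have h1 := hX.eta_le_one s q
    calc X.eta s q * A + (1 - X.eta s q) * B
        ≤ X.eta s q * x⁻¹ ^ k + (1 - X.eta s q) * (y q * x⁻¹ ^ k) :=
          add_le_add (mul_le_mul_of_nonneg_left hA h0.le)
            (mul_le_mul_of_nonneg_left hB (by linarith))
      _ = x * (X.eta s q + (1 - X.eta s q) * y q) * x⁻¹ ^ (k + 1) := by
          rw [pow_succ]; field_simp
      _ ≤ y q * x⁻¹ ^ (k + 1) := mul_le_mul_of_nonneg_right (hy q hq) (by positivity)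
  -- The induction is on the number of steps because a deletion leaves the word length unchanged.
  induction n with
  | zero =>
    refine ⟨fun i k => ?_, fun q hq i k => ?_⟩
    · cases k with
      | zero => simp [wordSum, prefixProb]
      | succ k =>
        have h : ∀ b : α, wordSum k (fun _ : List α => (0 : ℝ)) = 0 := fun b => by
          simpa using wordSum_const_mul k 0 fun _ : List α => (0 : ℝ)
        simp only [wordSum, prefixProb, ne_eq, OfNat.ofNat_ne_zero, not_false_eq_true, zero_pow]
        rw [Finset.sum_congr rfl fun b _ => h b, Finset.sum_const_zero]
        positivity
    · cases k with
      | zero => simpa [wordSum, prefixProb] using hy1 q hq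
      | succ k =>
        have h : ∀ b : α, wordSum k (fun _ : List α => (0 : ℝ)) = 0 := fun b => by
          simpa using wordSum_const_mul k 0 fun _ : List α => (0 : ℝ)
        simp only [wordSum, prefixProb, ne_eq, OfNat.ofNat_ne_zero, not_false_eq_true, zero_pow]
        rw [Finset.sum_congr rfl fun b _ => h b, Finset.sum_const_zero]
        have := hy1 q hq
        positivity
  | succ n ih =>
    obtain ⟨ihS, ihW⟩ := ih
    refine ⟨fun i k => ?_, fun q hq i k => ?_⟩
    · cases k with
      | zero => simp [wordSum, prefixProb_nil]
      | succ k =>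
        have hp : 0 ≤ X.del s (t i) := X.μR_nonneg _ _ _
        have hρ : ∀ q, 0 ≤ X.rho s (t i) q := fun q => X.μR_nonneg _ _ _
        have hstep : ∀ b v, X.prefixProb t (n + 1) (Sum.inl s) i (b :: v) ^ 2 ≤
            δ * (X.del s (t i) * X.prefixProb t n (Sum.inl s) (i + 1) (b :: v) ^ 2 +
              ∑ q, X.rho s (t i) q * ∑ p, X.μW q b p * X.prefixProb t n p (i + 1) v ^ 2) :=
          fun b v => (hX.prefixProb_inl_sq_le t n i b v).trans <|
            mul_le_mul_of_nonneg_right (hδ _ _) <| add_nonneg (mul_nonneg hp (sq_nonneg _)) <|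
              Finset.sum_nonneg fun q _ => mul_nonneg (hρ q) <| Finset.sum_nonneg fun p _ =>
                mul_nonneg (X.μW_nonneg _ _ _) (sq_nonneg _)
        have hS := ihS (i + 1) (k + 1)
        rw [wordSum] at hS
        calc wordSum (k + 1) (fun v => X.prefixProb t (n + 1) (Sum.inl s) i v ^ 2)
            ≤ ∑ b, wordSum k fun v =>
              δ * (X.del s (t i) * X.prefixProb t n (Sum.inl s) (i + 1) (b :: v) ^ 2 +
                ∑ q, X.rho s (t i) q * ∑ p, X.μW q b p * X.prefixProb t n p (i + 1) v ^ 2) :=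
              Finset.sum_le_sum fun b _ => wordSum_mono k (hstep b)
          _ = δ * (X.del s (t i) * (∑ b, wordSum k fun v =>
                X.prefixProb t n (Sum.inl s) (i + 1) (b :: v) ^ 2) +
              ∑ q, X.rho s (t i) q * ∑ b, wordSum k fun v =>
                ∑ p, X.μW q b p * X.prefixProb t n p (i + 1) v ^ 2) := by
              simp only [wordSum_const_mul, wordSum_add, wordSum_sum, Finset.mul_sum,
                Finset.sum_add_distrib, mul_add]
              congr 1
              rw [Finset.sum_comm]
          _ ≤ δ * (X.del s (t i) * x⁻¹ ^ (k + 1) +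
              ∑ q, X.rho s (t i) q * (y q * x⁻¹ ^ (k + 1))) := by
              refine mul_le_mul_of_nonneg_left (add_le_add (mul_le_mul_of_nonneg_left hS hp)
                (Finset.sum_le_sum fun q _ => ?_)) hδ0
              -- Nothing is known about y at output states that are not good; their weight vanishes
              -- here.
              by_cases h : X.rho s (t i) q = 0
              · rw [h, zero_mul, zero_mul]
              · rw [hX.sum_wordSum_μW s q k fun p v => X.prefixProb t n p (i + 1) v ^ 2]
                have hq := hgood _ q h
                exact mul_le_mul_of_nonneg_left (hmix q hq (ihS _ _) (ihW q hq _ _)) (hρ q)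
          _ = δ * (X.del s (t i) + ∑ q, X.rho s (t i) q * y q) * x⁻¹ ^ (k + 1) := by
              simp only [← mul_assoc, ← Finset.sum_mul]; ring
          _ ≤ x⁻¹ ^ (k + 1) := mul_le_of_le_one_left (by positivity) (hF _)
    · cases k with
      | zero => simpa [wordSum, prefixProb_nil] using hy1 q hq
      | succ k =>
        calc wordSum (k + 1) (fun v => X.prefixProb t (n + 1) (Sum.inr q) i v ^ 2)
            ≤ ∑ b, wordSum k fun v => ∑ p, X.μW q b p * X.prefixProb t n p i v ^ 2 :=
              Finset.sum_le_sum fun b _ => wordSum_mono k (X.prefixProb_inr_sq_le t n q i b)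
          _ ≤ y q * x⁻¹ ^ (k + 1) := by
              rw [hX.sum_wordSum_μW s q k fun p v => X.prefixProb t n p i v ^ 2]
              exact hmix q hq (ihS _ _) (ihW q hq _ _)

end PFA

/-! ### From the law of the run to prefix probabilities -/

instance {α R W : Type*} : DiscreteMeasurableSpace (PFAConfig α R W) :=
  ⟨fun _ => MeasurableSpace.measurableSet_top⟩

instance {α R W : Type*} [Finite α] [Finite R] [Finite W] : Countable (PFAConfig α R W) :=
  Function.Injective.countable (f := fun c : PFAConfig α R W => (c.state, c.read, c.out))
    fun c d h => by cases c; cases d; simpa using h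

theorem measurable_pfaConfig_comp₂ {α R W Ω : Type*} [Finite α] [Finite R] [Finite W]
    [MeasurableSpace Ω] (g : PFAConfig α R W → PFAConfig α R W → ℝ≥0∞) {a b : Ω → PFAConfig α R W}
    (ha : Measurable a) (hb : Measurable b) : Measurable fun ω => g (a ω) (b ω) :=
  (Measurable.of_discrete (f := fun z : PFAConfig α R W × PFAConfig α R W => g z.1 z.2)).comp
    (ha.prodMk hb)

theorem lintegral_toMeasure_map_pmfOfReal {β γ : Type*} [Fintype β] [MeasurableSpace γ]
    [DiscreteMeasurableSpace γ] (f : β → ℝ) (h0 : ∀ b, 0 ≤ f b) (h1 : ∑ b, f b = 1) (φ : β → γ)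
    (g : γ → ℝ≥0∞) :
    ∫⁻ c, g c ∂((pmfOfReal f h0 h1).map φ).toMeasure = ∑ b, ENNReal.ofReal (f b) * g (φ b) := by
  let _ : MeasurableSpace β := ⊤
  have : MeasurableSingletonClass β := ⟨fun _ => MeasurableSpace.measurableSet_top⟩
  rw [← PMF.toMeasure_map φ (pmfOfReal f h0 h1) measurable_from_top,
    lintegral_map (Measurable.of_discrete) measurable_from_top, lintegral_fintype]
  refine Finset.sum_congr rfl fun b _ => ?_
  rw [PMF.toMeasure_apply_singleton _ _ (MeasurableSpace.measurableSet_top), mul_comm]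
  rfl

namespace PFA

variable {α R W : Type*} [Fintype α] [Fintype R] [Fintype W] (X : PFA α R W) (t : ℕ → α)

theorem lintegral_stepKernel_inl (q : R) (i : ℕ) (o : List α) (g : PFAConfig α R W → ℝ≥0∞) :
    ∫⁻ c, g c ∂X.stepKernel t ⟨Sum.inl q, i, o⟩ =
      ∑ p, ENNReal.ofReal (X.μR q (t i) p) * g ⟨p, i + 1, o⟩ :=
  lintegral_toMeasure_map_pmfOfReal _ _ _ _ g

theorem lintegral_stepKernel_inr (q : W) (i : ℕ) (o : List α) (g : PFAConfig α R W → ℝ≥0∞) :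
    ∫⁻ c, g c ∂X.stepKernel t ⟨Sum.inr q, i, o⟩ =
      ∑ a, ∑ p, ENNReal.ofReal (X.μW q a p) * g ⟨p, i, o ++ [a]⟩ :=
  (lintegral_toMeasure_map_pmfOfReal (fun ap : α × (R ⊕ W) => X.μW q ap.1 ap.2) _ _ _ g).trans
    (Fintype.sum_prod_type _)

theorem lintegral_runMeasure_zero (g : PFAConfig α R W → ℝ≥0∞) :
    ∫⁻ ω, g (ω 0) ∂X.runMeasure t = ∫⁻ c, g c ∂X.initial.toMeasure := by
  have hg : Measurable fun ω : ℕ → PFAConfig α R W => g (ω 0) :=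
    (Measurable.of_discrete (f := g)).comp (measurable_pi_apply 0)
  rw [runMeasure, Kernel.trajMeasure,
    Measure.lintegral_bind (Kernel.measurable _).aemeasurable hg.aemeasurable]
  have h : ∀ x₀ : (Π _ : Finset.Iic 0, PFAConfig α R W),
      ∫⁻ ω, g (ω 0) ∂Kernel.traj (X := fun _ => PFAConfig α R W) (fun k =>
        (X.stepKernel t).comap
          (fun h : (Π _ : Finset.Iic k, PFAConfig α R W) => h ⟨k, Finset.mem_Iic.mpr le_rfl⟩)
          (measurable_pi_apply _)) 0 x₀ = g (x₀ ⟨0, Finset.mem_Iic.mpr le_rfl⟩) := fun x₀ => by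
    have hm : Measurable fun y : (Π _ : Finset.Iic 0, PFAConfig α R W) =>
        g (y ⟨0, Finset.mem_Iic.mpr le_rfl⟩) :=
      (Measurable.of_discrete (f := g)).comp (measurable_pi_apply _)
    have := lintegral_map (μ := Kernel.traj (X := fun _ => PFAConfig α R W) (fun k =>
        (X.stepKernel t).comap
          (fun h : (Π _ : Finset.Iic k, PFAConfig α R W) => h ⟨k, Finset.mem_Iic.mpr le_rfl⟩)
          (measurable_pi_apply _)) 0 x₀) hm
        (Preorder.measurable_frestrictLe (X := fun _ => PFAConfig α R W) 0)
    rw [Kernel.traj_map_frestrictLe_apply, Kernel.partialTraj_self, Kernel.id_apply,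
      lintegral_dirac' _ hm] at this
    exact this.symm
  simp only [h]
  rw [lintegral_map_equiv]
  rfl

/-- The Markov property for two consecutive configurations, from the composition-product description
of the trajectory measure. -/
theorem lintegral_runMeasure_succ (n : ℕ)
    (g : PFAConfig α R W → PFAConfig α R W → ℝ≥0∞) :
    ∫⁻ ω, g (ω n) (ω (n + 1)) ∂X.runMeasure t =
      ∫⁻ ω, ∫⁻ c, g (ω n) c ∂X.stepKernel t (ω n) ∂X.runMeasure t := by
  have hg : Measurable fun z : (Π _ : Finset.Iic n, PFAConfig α R W) × PFAConfig α R W =>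
      g (z.1 ⟨n, Finset.mem_Iic.mpr le_rfl⟩) z.2 :=
    measurable_pfaConfig_comp₂ g ((measurable_pi_apply _).comp measurable_fst) measurable_snd
  have hr := Preorder.measurable_frestrictLe (X := fun _ => PFAConfig α R W) n
  have key := congrArg (fun μ => ∫⁻ z, g (z.1 ⟨n, Finset.mem_Iic.mpr le_rfl⟩) z.2 ∂μ)
    (Kernel.map_frestrictLe_trajMeasure_compProd_eq_map_trajMeasure
      (X := fun _ => PFAConfig α R W) (μ₀ := X.initial.toMeasure) (κ := fun k =>
      (X.stepKernel t).comap
        (fun h : (Π _ : Finset.Iic k, PFAConfig α R W) => h ⟨k, Finset.mem_Iic.mpr le_rfl⟩)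
        (measurable_pi_apply _)) (a := n))
  beta_reduce at key
  rw [Measure.lintegral_compProd hg, lintegral_map hg.lintegral_kernel_prod_right' hr,
    lintegral_map hg (hr.prodMk (measurable_pi_apply _))] at key
  exact key.symm

/-- The probability that the output has prefix `u` after `n` steps from a configuration. -/
noncomputable def reachProb (u : List α) : ℕ → PFAConfig α R W → ℝ≥0∞
  | 0, c => Set.indicator {c | u <+: c.out} 1 c
  | n + 1, c => ∫⁻ c', reachProb u n c' ∂X.stepKernel t c

theorem reachProb_le_one (u : List α) (n : ℕ) (c : PFAConfig α R W) :
    X.reachProb t u n c ≤ 1 := by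
  induction n generalizing c with
  | zero => exact Set.indicator_le_self' (fun _ _ => zero_le_one) c
  | succ n ih =>
    calc X.reachProb t u (n + 1) c ≤ ∫⁻ _, 1 ∂X.stepKernel t c := lintegral_mono fun c' => ih c'
      _ = 1 := by simp

/-- Output is never erased, so a mismatch with u is permanent. -/
theorem reachProb_eq_zero (u : List α) (n : ℕ) (p : R ⊕ W) (i : ℕ) (o : List α)
    (h1 : ¬ u <+: o) (h2 : ¬ o <+: u) : X.reachProb t u n ⟨p, i, o⟩ = 0 := by
  induction n generalizing p i o with
  | zero => simp [reachProb, h1]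
  | succ n ih =>
    cases p with
    | inl q => simp [reachProb, lintegral_stepKernel_inl, ih _ _ _ h1 h2]
    | inr q =>
      have h : ∀ a : α, ¬ u <+: o ++ [a] ∧ ¬ o ++ [a] <+: u := fun a => by
        refine ⟨fun h => ?_, fun h => h2 ((List.prefix_append _ _).trans h)⟩
        rcases List.prefix_or_prefix_of_prefix h (List.prefix_append o [a]) with h' | h'
        · exact h1 h'
        · exact h2 h'
      simp [reachProb, lintegral_stepKernel_inr, ih _ _ _ (h _).1 (h _).2]

/-- The output written so far matters only through the part of the target still missing. Writing any
symbol other than the next one of v is fatal, so a single term of the sum over symbols survives. -/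
theorem reachProb_append_le (n : ℕ) (p : R ⊕ W) (i : ℕ) (o v : List α) :
    X.reachProb t (o ++ v) n ⟨p, i, o⟩ ≤ ENNReal.ofReal (X.prefixProb t n p i v) := by
  induction n generalizing p i o v with
  | zero =>
    cases v with
    | nil => simp [reachProb, prefixProb]
    | cons b v =>
      have : ¬ o ++ b :: v <+: o := fun h => by simpa using h.length_le
      simp [reachProb, this]
  | succ n ih =>
    cases p with
    | inl q =>
      rw [reachProb, lintegral_stepKernel_inl, prefixProb, ENNReal.ofReal_sum_of_nonneg fun p _ =>
        mul_nonneg (X.μR_nonneg _ _ _) (X.prefixProb_nonneg _ _ _ _ _)]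
      refine Finset.sum_le_sum fun p _ => ?_
      rw [ENNReal.ofReal_mul (X.μR_nonneg _ _ _)]
      gcongr
      exact ih _ _ _ _
    | inr q =>
      cases v with
      | nil => simpa [prefixProb] using X.reachProb_le_one t _ _ _
      | cons b v =>
        rw [reachProb, lintegral_stepKernel_inr, prefixProb,
          ENNReal.ofReal_sum_of_nonneg fun p _ =>
            mul_nonneg (X.μW_nonneg _ _ _) (X.prefixProb_nonneg _ _ _ _ _),
          Finset.sum_eq_single b]
        · refine Finset.sum_le_sum fun p _ => ?_
          rw [ENNReal.ofReal_mul (X.μW_nonneg _ _ _)]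
          gcongr
          simpa using ih p i (o ++ [b]) v
        · intro a _ hab
          refine Finset.sum_eq_zero fun p _ => ?_
          rw [reachProb_eq_zero, mul_zero]
          · intro h
            have hl := h.length_le
            have : v = [] := by
              cases v with
              | nil => rfl
              | cons => simp at hl
            subst this
            have := List.IsPrefix.eq_of_length h (by simp)
            simp at this
            exact hab this.symm
          · intro h
            rw [List.prefix_append_right_inj] at h
            simp at h
            exact hab h
        · simp

/-- By the Markov property one step can be moved from the backward recursion to the run, so the
integral depends only on n + m. -/
theorem measure_prefix_out_eq_lintegral (u : List α) (n m : ℕ) :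
    ∫⁻ ω, X.reachProb t u m (ω n) ∂X.runMeasure t =
      X.runMeasure t {ω | u <+: (ω (n + m)).out} := by
  induction m generalizing n with
  | zero =>
    rw [← lintegral_indicator_one]
    · rfl
    · have h : MeasurableSet ((fun ω : ℕ → PFAConfig α R W => ω n) ⁻¹' {c | u <+: c.out}) :=
        measurable_pi_apply n MeasurableSet.of_discrete
      exact h
  | succ m ih =>
    have := X.lintegral_runMeasure_succ t n fun _ c => X.reachProb t u m c
    rw [show n + (m + 1) = n + 1 + m by ring, ← ih (n + 1), this]
    rfl

theorem measure_prefix_out_le {s : R} (hs : X.IsCanonical s) (u : List α) (n : ℕ) :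
    X.runMeasure t {ω | u <+: (ω n).out} ≤
      ENNReal.ofReal (X.prefixProb t n (Sum.inl s) 0 u) := by
  classical
  have h := X.measure_prefix_out_eq_lintegral t u 0 n
  rw [zero_add] at h
  rw [← h, X.lintegral_runMeasure_zero t, initial, lintegral_toMeasure_map_pmfOfReal]
  have hσ : ∀ p, p ≠ Sum.inl s → X.σ p = 0 := by
    intro p hp
    have h2 := X.σ_sum
    rw [← Finset.add_sum_erase _ _ (Finset.mem_univ (Sum.inl s)), hs.1, add_eq_left,
      Finset.sum_eq_zero_iff_of_nonneg fun p _ => X.σ_nonneg p] at h2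
    exact h2 p (by simp [hp])
  rw [Finset.sum_eq_single (Sum.inl s) (fun p _ hp => by rw [hσ p hp]; simp) (by simp), hs.1]
  simpa using X.reachProb_append_le t n (Sum.inl s) 0 [] u

theorem ae_out_prefix_out_succ (n : ℕ) :
    ∀ᵐ ω ∂X.runMeasure t, (ω n).out <+: (ω (n + 1)).out := by
  classical
  have h := X.lintegral_runMeasure_succ t n fun c c' => if c.out <+: c'.out then 0 else 1
  have h0 : ∀ c : PFAConfig α R W,
      ∫⁻ c', (if c.out <+: c'.out then 0 else 1) ∂X.stepKernel t c = 0 := by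
    rintro ⟨q | q, i, o⟩
    · simp [lintegral_stepKernel_inl]
    · simp [lintegral_stepKernel_inr]
  simp only [h0, lintegral_zero] at h
  rw [lintegral_eq_zero_iff] at h
  · filter_upwards [h] with ω hω
    simpa using hω
  · exact measurable_pfaConfig_comp₂ (fun c c' => if c.out <+: c'.out then 0 else 1)
      (measurable_pi_apply n) (measurable_pi_apply (n + 1))

end PFA

theorem exists_prefix_out_of_isStrPrefix_runOutput {α R W : Type*} {ω : ℕ → PFAConfig α R W}
    (hω : ∀ n, (ω n).out <+: (ω (n + 1)).out) {u : List α} (hu : IsStrPrefix u (runOutput ω)) :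
    ∃ n, u <+: (ω n).out := by
  classical
  have hmono : ∀ m n, m ≤ n → (ω m).out <+: (ω n).out := fun m n h => by
    induction n, h using Nat.le_induction with
    | base => exact List.prefix_rfl
    | succ n _ ih => exact ih.trans (hω n)
  have key : ∀ i < u.length, ∃ k, i < (ω k).out.length ∧ (ω k).out[i]? = u[i]? := by
    intro i hi
    have h := hu i hi
    simp only [runOutput, Stream'.Seq.get?] at h
    split_ifs at h with hk
    · exact ⟨Nat.find hk, Nat.find_spec hk, h⟩
    · rw [List.getElem?_eq_getElem hi] at h
      exact absurd h (by simp)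
  rcases Nat.eq_zero_or_pos u.length with h0 | hpos
  · exact ⟨0, by rw [List.length_eq_zero_iff.mp h0]; exact List.nil_prefix⟩
  -- At the time when the last position of u is filled, all earlier ones are filled too, and outputs
  -- at different times agree where both are defined.
  · obtain ⟨n, hn, -⟩ := key (u.length - 1) (by omega)
    refine ⟨n, ?_⟩
    rw [List.prefix_iff_getElem?]
    intro i hi
    obtain ⟨k, hk, hki⟩ := key i hi
    rw [List.getElem?_eq_getElem hi] at hki
    rw [← hki]
    have hin : i < (ω n).out.length := by omega
    rcases le_total k n with h | h
    · rw [List.getElem?_eq_getElem hk, List.getElem?_eq_getElem hin, (hmono k n h).getElem hk]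
    · rw [List.getElem?_eq_getElem hk, List.getElem?_eq_getElem hin, (hmono n k h).getElem hin]

namespace PFA

variable {α R W : Type*} [Fintype α] [Fintype R] [Fintype W] (X : PFA α R W) (t : ℕ → α)

/-- The limit of `prefixProb` as the number of steps tends to infinity, from the start in `s`. -/
noncomputable def outputPrefixProb (s : R) (v : List α) : ℝ :=
  ⨆ n, X.prefixProb t n (Sum.inl s) 0 v

theorem bddAbove_prefixProb (s : R) (v : List α) :
    BddAbove (Set.range fun n => X.prefixProb t n (Sum.inl s) 0 v) :=
  ⟨1, by rintro _ ⟨n, rfl⟩; exact X.prefixProb_le_one t n _ _ v⟩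

theorem tendsto_prefixProb (s : R) (v : List α) :
    Tendsto (fun n => X.prefixProb t n (Sum.inl s) 0 v) atTop
      (𝓝 (X.outputPrefixProb t s v)) :=
  tendsto_atTop_ciSup (X.monotone_prefixProb t _ _ v) (X.bddAbove_prefixProb t s v)

theorem outputPrefixProb_nonneg (s : R) (v : List α) : 0 ≤ X.outputPrefixProb t s v :=
  Real.iSup_nonneg fun n => X.prefixProb_nonneg t n _ _ v

theorem perturbation_isStrPrefix_le {s : R} (hs : X.IsCanonical s) (u : List α)
    (hu : MeasurableSet {x : Stream'.Seq α | IsStrPrefix u x}) :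
    (X.perturbation t : Measure (Stream'.Seq α)) {x | IsStrPrefix u x} ≤
      ENNReal.ofReal (X.outputPrefixProb t s u) := by
  have hG := ae_all_iff.mpr (X.ae_out_prefix_out_succ t)
  rw [perturbation, ProbabilityMeasure.coe_mk, Measure.map_apply measurable_runOutput hu]
  -- Including the almost sure growth of the output in E makes the events increasing everywhere, so
  -- continuity from below applies.
  let E : ℕ → Set (ℕ → PFAConfig α R W) := fun n =>
    {ω | u <+: (ω n).out ∧ ∀ n, (ω n).out <+: (ω (n + 1)).out}
  have hE : Monotone E := monotone_nat_of_le_succ fun n ω hω => ⟨hω.1.trans (hω.2 n), hω.2⟩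
  calc X.runMeasure t (runOutput ⁻¹' {x | IsStrPrefix u x}) ≤ X.runMeasure t (⋃ n, E n) := by
        refine measure_mono_ae ?_
        filter_upwards [hG] with ω hω hu
        obtain ⟨n, hn⟩ := exists_prefix_out_of_isStrPrefix_runOutput hω hu
        exact Set.mem_iUnion.mpr ⟨n, hn, hω⟩
    _ = ⨆ n, X.runMeasure t (E n) := hE.measure_iUnion
    _ ≤ ENNReal.ofReal (X.outputPrefixProb t s u) := by
        refine iSup_le fun n => (measure_mono fun ω hω => hω.1).trans <|
          (X.measure_prefix_out_le t hs u n).trans (ENNReal.ofReal_le_ofReal ?_)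
        exact le_ciSup (X.bddAbove_prefixProb t s u) n

end PFA

/-! ### Common prefixes and the expected height -/

theorem measurableSet_isStrPrefix {α : Type*} (u : List α) :
    MeasurableSet {x : Stream'.Seq α | IsStrPrefix u x} := by
  have h : {x : Stream'.Seq α | IsStrPrefix u x} =
      ⋂ i ∈ Set.Iio u.length, (fun x : Stream'.Seq α => x.get? i) ⁻¹' {u[i]?} := by
    ext x
    simp [IsStrPrefix]
  rw [h]
  refine MeasurableSet.biInter (Set.to_countable _) fun i _ => ?_
  exact (le_iSup (fun n : ℕ => MeasurableSpace.comap (fun x : Stream'.Seq α => x.get? n) ⊤) i) _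
    ⟨_, trivial, rfl⟩

theorem IsStrPrefix.take {α : Type*} {u : List α} {x : Stream'.Seq α} (h : IsStrPrefix u x)
    (k : ℕ) : IsStrPrefix (u.take k) x := by
  intro i hi
  rw [List.length_take] at hi
  rw [List.getElem?_take_of_lt (by omega)]
  exact h i (by omega)

/-- The supremum may be infinite and need not be attained, but exceeding k - 1 produces a common
prefix of length at least k, which can be truncated. -/
theorem le_lcp_iff {α : Type*} {k : ℕ} {x y : Stream'.Seq α} :
    (k : ℕ∞) ≤ lcp x y ↔ ∃ u : List α, u.length = k ∧ IsStrPrefix u x ∧ IsStrPrefix u y := by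
  constructor
  · intro h
    cases k with
    | zero => exact ⟨[], rfl, fun i hi => by simp at hi, fun i hi => by simp at hi⟩
    | succ k =>
      have h' : (k : ℕ∞) < lcp x y := lt_of_lt_of_le (by exact_mod_cast Nat.lt_succ_self k) h
      simp only [lcp, lt_iSup_iff] at h'
      obtain ⟨u, ⟨hx, hy⟩, hu⟩ := h'
      have hu' : k < u.length := by exact_mod_cast hu
      exact ⟨u.take (k + 1), by rw [List.length_take]; omega, hx.take _, hy.take _⟩
  · rintro ⟨u, rfl, hx, hy⟩
    exact le_iSup₂_of_le u ⟨hx, hy⟩ le_rfl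

/-- Union bound over words, one first letter at a time. -/
theorem measure_exists_word_le {α Ω : Type*} [Fintype α] [MeasurableSpace Ω] (μ : Measure Ω)
    (k : ℕ) {C : List α → Set Ω} {g : List α → ℝ} (hg : ∀ u, 0 ≤ g u)
    (h : ∀ u, μ (C u) ≤ ENNReal.ofReal (g u)) :
    μ {ω | ∃ u, u.length = k ∧ ω ∈ C u} ≤ ENNReal.ofReal (wordSum k g) := by
  induction k generalizing C g with
  | zero =>
    refine (measure_mono ?_).trans (h [])
    rintro ω ⟨u, hu, hω⟩
    rwa [List.length_eq_zero_iff.mp hu] at hω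
  | succ k ih =>
    rw [wordSum, ENNReal.ofReal_sum_of_nonneg fun b _ => wordSum_nonneg k fun u => hg _]
    refine (measure_mono (t := ⋃ b, {ω | ∃ u : List α, u.length = k ∧ ω ∈ C (b :: u)}) ?_).trans
      ((measure_iUnion_fintype_le _ _).trans
        (Finset.sum_le_sum fun b _ => ih (fun u => hg _) fun u => h _))
    rintro ω ⟨u, hu, hω⟩
    cases u with
    | nil => simp at hu
    | cons b u => exact Set.mem_iUnion.mpr ⟨b, u, by simpa using hu, hω⟩

/-- Layer-cake bound started at level K; for an infinite value the series diverges. -/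
theorem ENat.toENNReal_le_add_tsum (m : ℕ∞) (K : ℕ) :
    (m : ℝ≥0∞) ≤ K + ∑' j : ℕ, if ((K + j + 1 : ℕ) : ℕ∞) ≤ m then 1 else 0 := by
  induction m with
  | top => simp
  | coe m =>
    have h : ∑ j ∈ Finset.range (m - K), (if ((K + j + 1 : ℕ) : ℕ∞) ≤ m then (1 : ℝ≥0∞) else 0) =
        ((m - K : ℕ) : ℝ≥0∞) := by
      rw [Finset.sum_congr rfl (g := fun _ => 1), Finset.sum_const, Finset.card_range, nsmul_one]
      intro j hj
      rw [Finset.mem_range] at hj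
      rw [if_pos (by exact_mod_cast (by omega : K + j + 1 ≤ m))]
    calc ((m : ℕ∞) : ℝ≥0∞) = (m : ℝ≥0∞) := by simp
      _ ≤ ((K + (m - K) : ℕ) : ℝ≥0∞) := by exact_mod_cast (by omega : m ≤ K + (m - K))
      _ = K + ((m - K : ℕ) : ℝ≥0∞) := by push_cast; rfl
      _ ≤ _ := by rw [← h]; gcongr; exact ENNReal.sum_le_tsum _

theorem measurableSet_le_lcp {α Ω : Type*} [Finite α] [MeasurableSpace Ω]
    {X Y : Ω → Stream'.Seq α} (hX : Measurable X) (hY : Measurable Y) (k : ℕ) :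
    MeasurableSet {ω | (k : ℕ∞) ≤ lcp (X ω) (Y ω)} := by
  have h : {ω | (k : ℕ∞) ≤ lcp (X ω) (Y ω)} = ⋃ u ∈ {u : List α | u.length = k},
      X ⁻¹' {x | IsStrPrefix u x} ∩ Y ⁻¹' {x | IsStrPrefix u x} := by
    ext ω
    simp only [le_lcp_iff, Set.mem_ofPred_eq, Set.mem_iUnion, Set.mem_inter_iff,
      Set.mem_preimage, exists_prop]
  rw [h]
  exact MeasurableSet.biUnion (Set.to_countable _) fun u _ =>
    (hX (measurableSet_isStrPrefix u)).inter (hY (measurableSet_isStrPrefix u))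

/-- If every two perturbed strings share a prefix of length `k` with probability at most `r ^ k`,
then the smoothed trie height is at most `K` plus a geometric tail. -/
theorem smoothedTrieHeight_le {α : Type*} [Finite α] (S : Set (ℕ → α)) (n : ℕ)
    (X : StringPerturbation α) {r : ℝ} (hr0 : 0 ≤ r) (hr1 : r < 1)
    (h : ∀ (A : Finset (ℕ → α)) (s t : A), s ≠ t → ∀ k : ℕ,
      (Measure.pi fun s : A => (X (s : ℕ → α) : Measure (Stream'.Seq α)))
        {x | (k : ℕ∞) ≤ lcp (x s) (x t)} ≤ ENNReal.ofReal (r ^ k)) (K : ℕ) :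
    smoothedTrieHeight S n X ≤
      ENNReal.ofReal (K + n ^ 2 * (r ^ (K + 1) * (1 - r)⁻¹)) := by
  refine iSup₂_le fun A hA => ?_
  set P := Measure.pi fun s : A => (X (s : ℕ → α) : Measure (Stream'.Seq α)) with hP
  let E : A → A → ℕ → Set (A → Stream'.Seq α) := fun s t j =>
    {x | s ≠ t ∧ ((K + j + 1 : ℕ) : ℕ∞) ≤ lcp (x s) (x t)}
  have hE : ∀ s t j, MeasurableSet (E s t j) := fun s t j =>
    (MeasurableSet.const (s ≠ t)).inter
      (measurableSet_le_lcp (measurable_pi_apply s) (measurable_pi_apply t) _)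
  have hPE : ∀ s t j, P (E s t j) ≤ ENNReal.ofReal (r ^ (K + j + 1)) := by
    intro s t j
    by_cases hst : s = t
    · simp [E, hst]
    · exact (measure_mono fun x hx => hx.2).trans (h A s t hst (K + j + 1))
  have hsum : ∑' j : ℕ, ENNReal.ofReal (r ^ (K + j + 1)) =
      ENNReal.ofReal (r ^ (K + 1) * (1 - r)⁻¹) := by
    have : ∀ j, r ^ (K + j + 1) = r ^ (K + 1) * r ^ j := fun j => by ring
    simp only [this]
    rw [← tsum_geometric_of_lt_one hr0 hr1, ← tsum_mul_left, ENNReal.ofReal_tsum_of_nonneg]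
    · exact fun j => by positivity
    · exact (summable_geometric_of_lt_one hr0 hr1).mul_left _
  calc ∫⁻ x : A → Stream'.Seq α,
        (⨆ (s : A) (t : A) (_ : s ≠ t), ((lcp (x s) (x t) : ℕ∞) : ℝ≥0∞)) ∂P
      ≤ ∫⁻ x, (K + ∑ s : A, ∑ t : A, ∑' j : ℕ, (E s t j).indicator 1 x) ∂P := by
        -- The maximum is dominated by a sum over all ordered pairs. The dominating function is
        -- measurable, so measurability of the maximum is not needed.
        refine lintegral_mono fun x => iSup_le fun s => iSup_le fun t => iSup_le fun hst => ?_
        refine (ENat.toENNReal_le_add_tsum _ K).trans (add_le_add le_rfl ?_)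
        refine le_trans ?_ (Finset.single_le_sum (f := fun s : A => ∑ t : A, ∑' j : ℕ,
          (E s t j).indicator (1 : (A → Stream'.Seq α) → ℝ≥0∞) x)
          (fun _ _ => zero_le) (Finset.mem_univ s))
        refine le_trans ?_ (Finset.single_le_sum (f := fun t : A => ∑' j : ℕ,
          (E s t j).indicator (1 : (A → Stream'.Seq α) → ℝ≥0∞) x)
          (fun _ _ => zero_le) (Finset.mem_univ t))
        refine ENNReal.tsum_le_tsum fun j => le_of_eq ?_
        simp [E, Set.indicator_apply, hst]
    _ = K + ∑ s : A, ∑ t : A, ∑' j : ℕ, P (E s t j) := by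
        have hm : ∀ s t j, Measurable ((E s t j).indicator (1 : (A → Stream'.Seq α) → ℝ≥0∞)) :=
          fun s t j => measurable_one.indicator (hE s t j)
        rw [lintegral_add_left measurable_const, lintegral_const, measure_univ, mul_one,
          lintegral_finsetSum _ fun s _ => Finset.measurable_sum _ fun t _ =>
            Measurable.tsum fun j => hm s t j]
        congr 1
        refine Finset.sum_congr rfl fun s _ => ?_
        rw [lintegral_finsetSum _ fun t _ => Measurable.tsum fun j => hm s t j]
        refine Finset.sum_congr rfl fun t _ => ?_
        rw [lintegral_tsum fun j => (hm s t j).aemeasurable]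
        simp only [lintegral_indicator_one (hE s t _)]
    _ ≤ K + ∑ s : A, ∑ t : A, ∑' j : ℕ, ENNReal.ofReal (r ^ (K + j + 1)) := by
        gcongr
        exact hPE _ _ _
    _ = ENNReal.ofReal (K + n ^ 2 * (r ^ (K + 1) * (1 - r)⁻¹)) := by
        have h1 : 0 ≤ r ^ (K + 1) * (1 - r)⁻¹ :=
          mul_nonneg (by positivity) (inv_nonneg.mpr (by linarith))
        rw [hsum]
        generalize r ^ (K + 1) * (1 - r)⁻¹ = c at h1
        rw [ENNReal.ofReal_add (by positivity) (by positivity), ENNReal.ofReal_natCast,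
          ENNReal.ofReal_mul (by positivity), ← Nat.cast_pow, ENNReal.ofReal_natCast]
        simp [hA.2, sq, mul_assoc]

namespace PFA

variable {α R W : Type*} [Fintype α] [Fintype R] [Fintype W] (X : PFA α R W)

theorem measure_le_lcp_le {s : R} (hs : X.IsCanonical s) {r : ℝ} {A : Finset (ℕ → α)}
    {t t' : A} (htt : t ≠ t') {k : ℕ}
    (h : ∀ t : A, wordSum k (fun v => X.outputPrefixProb t s v ^ 2) ≤ r ^ k) :
    (Measure.pi fun t : A => (X.perturbation (t : ℕ → α) : Measure (Stream'.Seq α)))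
      {x | (k : ℕ∞) ≤ lcp (x t) (x t')} ≤ ENNReal.ofReal (r ^ k) := by
  let C : List α → Set (A → Stream'.Seq α) := fun u =>
    {x | IsStrPrefix u (x t) ∧ IsStrPrefix u (x t')}
  have hind := (iIndepFun_pi (μ := fun t : A =>
    (X.perturbation (t : ℕ → α) : Measure (Stream'.Seq α))) (X := fun _ x => x)
    fun _ => aemeasurable_id).indepFun htt
  have hC : ∀ u, (Measure.pi fun t : A =>
      (X.perturbation (t : ℕ → α) : Measure (Stream'.Seq α))) (C u) ≤
        ENNReal.ofReal (X.outputPrefixProb t s u * X.outputPrefixProb t' s u) := by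
    intro u
    have hu := measurableSet_isStrPrefix u
    have h1 := hind.measure_inter_preimage_eq_mul _ _ hu hu
    have h2 : ∀ t : A, (Measure.pi fun t : A =>
        (X.perturbation (t : ℕ → α) : Measure (Stream'.Seq α)))
        ((fun ω => ω t) ⁻¹' {x | IsStrPrefix u x}) =
        (X.perturbation (t : ℕ → α) : Measure (Stream'.Seq α)) {x | IsStrPrefix u x} := fun t =>
      (measurePreserving_eval (fun t : A =>
        (X.perturbation (t : ℕ → α) : Measure (Stream'.Seq α))) t).measure_preimage
        hu.nullMeasurableSet
    rw [h2, h2] at h1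
    rw [ENNReal.ofReal_mul (X.outputPrefixProb_nonneg _ _ _)]
    refine (le_of_eq h1).trans ?_
    gcongr
    · exact X.perturbation_isStrPrefix_le t hs u hu
    · exact X.perturbation_isStrPrefix_le t' hs u hu
  have hset : {x : A → Stream'.Seq α | (k : ℕ∞) ≤ lcp (x t) (x t')} =
      {x | ∃ u : List α, u.length = k ∧ x ∈ C u} := by
    ext x
    exact le_lcp_iff
  rw [hset]
  refine (measure_exists_word_le _ k (fun u => mul_nonneg (X.outputPrefixProb_nonneg _ _ _)
    (X.outputPrefixProb_nonneg _ _ _)) hC).trans (ENNReal.ofReal_le_ofReal ?_)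
  calc wordSum k (fun u => X.outputPrefixProb t s u * X.outputPrefixProb t' s u)
      ≤ wordSum k (fun u => 1 / 2 * (X.outputPrefixProb t s u ^ 2) +
          1 / 2 * (X.outputPrefixProb t' s u ^ 2)) :=
        wordSum_mono k fun u => by
          nlinarith [sq_nonneg (X.outputPrefixProb t s u - X.outputPrefixProb t' s u)]
    _ = 1 / 2 * wordSum k (fun u => X.outputPrefixProb t s u ^ 2) +
          1 / 2 * wordSum k (fun u => X.outputPrefixProb t' s u ^ 2) := by
        rw [wordSum_add, wordSum_const_mul, wordSum_const_mul]
    _ ≤ r ^ k := by linarith [h t, h t']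

end PFA

/-! ### Location of the dominant pole -/

theorem Complex.re_div_one_sub_mul_lt {c x : ℝ} {w : ℂ} (hc : 0 ≤ c) (hcx : c * x < 1)
    (hw : ‖w‖ ≤ x) (hne : w ≠ x) : (w / (1 - c * w)).re < x / (1 - c * x) := by
  have hu : w.re < x := by
    refine lt_of_le_of_ne ((Complex.re_le_norm w).trans hw) fun h => hne ?_
    have h2 : ‖w‖ ^ 2 ≤ x ^ 2 := pow_le_pow_left₀ (norm_nonneg w) hw 2
    rw [Complex.sq_norm, Complex.normSq_apply, h] at h2
    have h3 : w.im = 0 := by nlinarith [mul_self_nonneg w.im]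
    exact Complex.ext (by simpa using h) (by simpa using h3)
  have hcu : 0 < 1 - c * w.re := by nlinarith
  have hN : 0 < (1 - c * w.re) ^ 2 + (c * w.im) ^ 2 := by positivity
  have hre : (w / (1 - c * w)).re =
      (w.re - c * (w.re ^ 2 + w.im ^ 2)) / ((1 - c * w.re) ^ 2 + (c * w.im) ^ 2) := by
    rw [Complex.div_re, ← add_div]
    congr 1
    · simp; ring
    · rw [Complex.normSq_apply]; simp; ring
  rw [hre, div_lt_div_iff₀ hN (by linarith)]
  -- The difference of the cross products is exactly (x - Re w)(1 - c Re w) + c (Im w)².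
  nlinarith [mul_pos (sub_pos.mpr hu) hcu, mul_nonneg hc (sq_nonneg w.im)]

namespace PFA

variable {α R W : Type*} [Fintype α] [Fintype R] [Fintype W] {X : PFA α R W} {s : R} {δ : ℝ}

/-- The generating function of the output lengths on the input symbol `a`, weighted by `δ`. -/
noncomputable def symbolGenFun (X : PFA α R W) (s : R) (δ : ℝ) (a : α) (x : ℝ) : ℝ :=
  δ * (X.del s a + ∑ q, X.rho s a q * (X.eta s q * x / (1 - (1 - X.eta s q) * x)))

/-- The point `x` lies within the radius of convergence of `symbolGenFun` at `a`. -/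
def IsConvergent (X : PFA α R W) (s : R) (a : α) (x : ℝ) : Prop :=
  ∀ q, X.rho s a q ≠ 0 → (1 - X.eta s q) * x < 1

theorem rho_nonneg (X : PFA α R W) (s : R) (a : α) (q : W) : 0 ≤ X.rho s a q :=
  X.μR_nonneg _ _ _

theorem IsStarLike.exists_rho_ne_zero (hX : X.IsStarLike) {a : α} (ha : X.del s a < 1) :
    ∃ q, X.rho s a q ≠ 0 := by
  by_contra! h
  have := hX.del_add_sum_rho s a
  simp only [h, Finset.sum_const_zero, add_zero] at this
  linarith

/-- Summed over b, the output weights of each state total 1. If δ ≤ 0, then Σ ρ_{a,q} ≤ 0, which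
forces p_a = 1. -/
theorem IsStarLike.pos_of_condTerm_le (hX : X.IsStarLike) {a : α} (ha : X.del s a < 1)
    (hδ : ∀ b, X.condTerm s a b ≤ δ) : 0 < δ := by
  by_contra! h
  have h1 : ∑ b, X.condTerm s a b ≤ 0 := Finset.sum_nonpos fun b _ => (hδ b).trans h
  have h2 : ∑ b, X.condTerm s a b = ∑ _b : α, X.del s a + ∑ q, X.rho s a q := by
    simp only [condTerm, Finset.sum_add_distrib]
    congr 1
    rw [Finset.sum_comm]
    refine Finset.sum_congr rfl fun q _ => ?_
    rw [← Finset.mul_sum, Finset.sum_add_distrib, hX.sum_loop s, eta]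
    simp [rho]
  have h3 : 0 ≤ ∑ _b : α, X.del s a := Finset.sum_nonneg fun _ _ => X.μR_nonneg _ _ _
  have h4 := hX.del_add_sum_rho s a
  linarith

theorem IsConvergent.mono {a : α} {x z : ℝ} (hX : X.IsStarLike) (h : X.IsConvergent s a z)
    (hxz : x ≤ z) : X.IsConvergent s a x := fun q hq =>
  (mul_le_mul_of_nonneg_left hxz (by linarith [hX.eta_le_one s q])).trans_lt (h q hq)

theorem IsStarLike.symbolGenFun_mono (hX : X.IsStarLike) (hδ : 0 ≤ δ) {a : α} {x z : ℝ}
    (hx : 0 ≤ x) (hxz : x ≤ z) (hz : X.IsConvergent s a z) :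
    X.symbolGenFun s δ a x ≤ X.symbolGenFun s δ a z := by
  refine mul_le_mul_of_nonneg_left (add_le_add le_rfl (Finset.sum_le_sum fun q _ => ?_)) hδ
  by_cases h : X.rho s a q = 0
  · rw [h, zero_mul, zero_mul]
  · have h1 := hX.eta_pos s q
    have h2 := hX.eta_le_one s q
    refine mul_le_mul_of_nonneg_left (div_le_div₀ ?_ ?_ ?_ ?_) (X.rho_nonneg s a q)
    · exact mul_nonneg h1.le (hx.trans hxz)
    · exact mul_le_mul_of_nonneg_left hxz h1.le
    · linarith [hz q h]
    · linarith [mul_le_mul_of_nonneg_left hxz (by linarith : 0 ≤ 1 - X.eta s q)]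

theorem IsStarLike.symbolGenFun_one (hX : X.IsStarLike) (a : α) :
    X.symbolGenFun s δ a 1 = δ := by
  have h : ∀ q, X.rho s a q * (X.eta s q * 1 / (1 - (1 - X.eta s q) * 1)) = X.rho s a q :=
    fun q => by
      have := (hX.eta_pos s q).ne'
      rw [mul_one, mul_one, sub_sub_cancel, div_self this, mul_one]
  rw [symbolGenFun, Finset.sum_congr rfl fun q _ => h q, hX.del_add_sum_rho, mul_one]

theorem IsStarLike.continuousOn_symbolGenFun (hX : X.IsStarLike) {a : α} {z : ℝ}
    (hz : X.IsConvergent s a z) : ContinuousOn (X.symbolGenFun s δ a) (Set.Iic z) := by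
  refine continuousOn_const.mul (continuousOn_const.add (continuousOn_finsetSum _ fun q _ => ?_))
  by_cases h : X.rho s a q = 0
  · simp only [h, zero_mul]
    exact continuousOn_const
  · refine continuousOn_const.mul (ContinuousOn.div (by fun_prop) (by fun_prop) fun x hx => ?_)
    linarith [hz.mono hX hx q h]

theorem IsStarLike.exists_symbolGenFun_eq_one (hX : X.IsStarLike) {a : α} (ha : X.del s a < 1)
    (hδ0 : 0 < δ) (hδ1 : δ < 1) :
    ∃ z, 1 < z ∧ X.IsConvergent s a z ∧ X.symbolGenFun s δ a z = 1 := by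
  classical
  obtain ⟨q₁, hq₁⟩ := hX.exists_rho_ne_zero ha
  -- The reachable state of least η has the singularity closest to the origin, so convergence for it
  -- implies convergence for all reachable states.
  obtain ⟨q, hq, hmin⟩ := Finset.exists_min_image (Finset.univ.filter fun q => X.rho s a q ≠ 0)
    (fun q => X.eta s q) ⟨q₁, by simpa using hq₁⟩
  simp only [Finset.mem_filter, Finset.mem_univ, true_and] at hq hmin
  have hρ : 0 < X.rho s a q := lt_of_le_of_ne (X.rho_nonneg s a q) hq.symm
  have hρ1 : X.rho s a q ≤ 1 := by
    have h1 := hX.del_add_sum_rho s a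
    have h2 : 0 ≤ X.del s a := X.μR_nonneg _ _ _
    have h3 := Finset.single_le_sum (fun q _ => X.rho_nonneg s a q) (Finset.mem_univ q)
    linarith
  have hη := hX.eta_pos s q
  have hη1 := hX.eta_le_one s q
  set η := X.eta s q with hηdef
  set ρ := X.rho s a q with hρdef
  have hpos : 0 < δ * ρ * η := by positivity
  have hD : 0 < δ * ρ * η + (1 - η) := by linarith
  -- At this point the contribution of q alone equals 1 and x is still below the singularity 1/(1 -
  -- η), so the intermediate value theorem applies on [1, x].
  set x := (δ * ρ * η + (1 - η))⁻¹ with hx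
  have hx0 : 0 < x := inv_pos.mpr hD
  have hxD : (δ * ρ * η + (1 - η)) * x = 1 := mul_inv_cancel₀ hD.ne'
  have hx1 : 1 ≤ x := by
    refine (one_le_inv₀ hD).mpr ?_
    have : δ * ρ ≤ 1 := by nlinarith
    nlinarith
  have hconv : X.IsConvergent s a x := fun q' hq' => by
    have h1 : (1 - X.eta s q') * x ≤ (1 - η) * x :=
      mul_le_mul_of_nonneg_right (by linarith [hmin q' hq']) hx0.le
    nlinarith [mul_pos hpos hx0]
  have hge : 1 ≤ X.symbolGenFun s δ a x := by
    have h1 : ρ * (η * x / (1 - (1 - η) * x)) ≤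
        ∑ q, X.rho s a q * (X.eta s q * x / (1 - (1 - X.eta s q) * x)) := by
      refine Finset.single_le_sum
        (f := fun q => X.rho s a q * (X.eta s q * x / (1 - (1 - X.eta s q) * x)))
        (fun q' _ => ?_) (Finset.mem_univ q)
      by_cases h : X.rho s a q' = 0
      · rw [h, zero_mul]
      · exact mul_nonneg (X.rho_nonneg s a q') (div_nonneg
          (mul_nonneg (hX.eta_pos s q').le hx0.le) (by linarith [hconv q' h]))
    have h2 : δ * (ρ * (η * x / (1 - (1 - η) * x))) = 1 := by
      have h3 : 1 - (1 - η) * x = δ * ρ * η * x := by linarith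
      have h4 := hx0.ne'
      rw [h3]
      field_simp
    have h3 : 0 ≤ X.del s a := X.μR_nonneg _ _ _
    refine h2.symm.le.trans ?_
    exact mul_le_mul_of_nonneg_left (by linarith) hδ0.le
  obtain ⟨z, hz, hz1⟩ := intermediate_value_Icc hx1
    ((hX.continuousOn_symbolGenFun (δ := δ) hconv).mono Set.Icc_subset_Iic_self)
    ⟨by rw [hX.symbolGenFun_one]; exact hδ1.le, hge⟩
  refine ⟨z, lt_of_le_of_ne hz.1 ?_, hconv.mono hX hz.2, hz1⟩
  rintro rfl
  rw [hX.symbolGenFun_one] at hz1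
  exact hδ1.ne hz1

/-- The least of the roots for the individual symbols: by monotonicity no other symbol exceeds 1
there. -/
theorem IsStarLike.exists_min_symbolGenFun_eq_one [Nonempty α] (hX : X.IsStarLike)
    (hdel : ∀ a, X.del s a < 1) (hδ0 : 0 < δ) (hδ1 : δ < 1) :
    ∃ z, 1 < z ∧ (∀ a, X.IsConvergent s a z) ∧ (∀ a, X.symbolGenFun s δ a z ≤ 1) ∧
      ∃ a, X.symbolGenFun s δ a z = 1 := by
  choose z hz1 hconv hz using fun a => hX.exists_symbolGenFun_eq_one (hdel a) hδ0 hδ1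
  obtain ⟨a, ha⟩ := Finite.exists_min z
  refine ⟨z a, hz1 a, fun b => (hconv b).mono hX (ha b), fun b => ?_, a, hz a⟩
  rw [← hz b]
  exact hX.symbolGenFun_mono hδ0.le (by linarith [hz1 a]) (ha b) (hconv b)

/-- The factor of the denominator of `genFun` that belongs to the input symbol `a`. -/
noncomputable def genFunFactor (X : PFA α R W) (s : R) (δ : ℝ) (a : α) (z : ℂ) : ℂ :=
  1 - (δ : ℂ) * (X.del s a : ℂ) -
    ∑ q : W, (δ : ℂ) * (X.rho s a q : ℂ) * (X.eta s q : ℂ) * z /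
      (1 - (1 - (X.eta s q : ℂ)) * z)

theorem genFun_eq_inv (X : PFA α R W) (s : R) (δ : ℝ) :
    X.genFun s δ = (fun z => ∏ a, X.genFunFactor s δ a z)⁻¹ := by
  funext z
  rw [Pi.inv_apply, ← Finset.prod_inv_distrib]
  rfl

theorem genFunFactor_ofReal (a : α) (x : ℝ) :
    X.genFunFactor s δ a x = ((1 - X.symbolGenFun s δ a x : ℝ) : ℂ) := by
  rw [genFunFactor, symbolGenFun]
  push_cast
  rw [mul_add, Finset.mul_sum, sub_sub]
  congr 2
  refine Finset.sum_congr rfl fun q _ => ?_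
  ring

theorem IsStarLike.analyticAt_genFunFactor (hX : X.IsStarLike) {a : α} {x : ℝ}
    (hx : X.IsConvergent s a x) {w : ℂ} (hw : ‖w‖ ≤ x) :
    AnalyticAt ℂ (X.genFunFactor s δ a) w := by
  refine analyticAt_const.sub (Finset.analyticAt_fun_sum _ fun q _ => ?_)
  -- An unreachable state may have its singularity inside the disc, but its term is identically
  -- zero.
  by_cases h : X.rho s a q = 0
  · simp only [h, Complex.ofReal_zero, mul_zero, zero_mul, zero_div]
    exact analyticAt_const
  · refine AnalyticAt.div (by fun_prop) (by fun_prop) fun h0 => ?_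
    have h1 : (1 - (X.eta s q : ℂ)) * w = 1 := (sub_eq_zero.mp h0).symm
    have h2 := congrArg norm h1
    rw [norm_mul, norm_one, ← Complex.ofReal_one, ← Complex.ofReal_sub, Complex.norm_real,
      Real.norm_of_nonneg (by linarith [hX.eta_le_one s q])] at h2
    have := mul_le_mul_of_nonneg_left hw (by linarith [hX.eta_le_one s q] : 0 ≤ 1 - X.eta s q)
    linarith [hx q h]

/-- The real part of the factor is positive: each reachable state contributes strictly less than at
x, and p_a < 1 provides at least one such state. -/
theorem IsStarLike.genFunFactor_ne_zero (hX : X.IsStarLike) (hδ : 0 < δ) {a : α}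
    (ha : X.del s a < 1) {x : ℝ} (hx : X.IsConvergent s a x) (hx1 : X.symbolGenFun s δ a x ≤ 1)
    {w : ℂ} (hw : ‖w‖ ≤ x) (hne : w ≠ x) : X.genFunFactor s δ a w ≠ 0 := by
  have hterm : ∀ q, X.rho s a q ≠ 0 → (w / (1 - ((1 - X.eta s q : ℝ) : ℂ) * w)).re <
      x / (1 - (1 - X.eta s q) * x) := fun q hq =>
    Complex.re_div_one_sub_mul_lt (by linarith [hX.eta_le_one s q]) (hx q hq) hw hne
  have hre : (X.genFunFactor s δ a w).re = 1 - δ * (X.del s a + ∑ q, X.rho s a q *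
      (X.eta s q * (w / (1 - ((1 - X.eta s q : ℝ) : ℂ) * w)).re)) := by
    have h : X.genFunFactor s δ a w = ((1 - δ * X.del s a : ℝ) : ℂ) -
        ∑ q, ((δ * (X.rho s a q * X.eta s q) : ℝ) : ℂ) *
          (w / (1 - ((1 - X.eta s q : ℝ) : ℂ) * w)) := by
      rw [genFunFactor]
      push_cast
      congr 1
      refine Finset.sum_congr rfl fun q _ => ?_
      ring
    rw [h, Complex.sub_re, Complex.re_sum, Complex.ofReal_re, mul_add, Finset.mul_sum, sub_sub]
    congr 2
    refine Finset.sum_congr rfl fun q _ => ?_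
    rw [Complex.re_ofReal_mul]
    ring
  intro h0
  rw [h0, Complex.zero_re] at hre
  obtain ⟨q₀, hq₀⟩ := hX.exists_rho_ne_zero ha
  have hlt : ∀ q, X.rho s a q ≠ 0 →
      X.rho s a q * (X.eta s q * (w / (1 - ((1 - X.eta s q : ℝ) : ℂ) * w)).re) <
        X.rho s a q * (X.eta s q * x / (1 - (1 - X.eta s q) * x)) := fun q hq => by
    rw [mul_div_assoc]
    exact mul_lt_mul_of_pos_left (mul_lt_mul_of_pos_left (hterm q hq) (hX.eta_pos s q))
      (lt_of_le_of_ne (X.rho_nonneg s a q) hq.symm)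
  have hsum := Finset.sum_lt_sum (s := Finset.univ)
    (f := fun q => X.rho s a q * (X.eta s q * (w / (1 - ((1 - X.eta s q : ℝ) : ℂ) * w)).re))
    (g := fun q => X.rho s a q * (X.eta s q * x / (1 - (1 - X.eta s q) * x)))
    (fun q _ => by
      by_cases h : X.rho s a q = 0
      · simp [h]
      · exact (hlt q h).le) ⟨q₀, Finset.mem_univ _, hlt q₀ hq₀⟩
  have := mul_lt_mul_of_pos_left ((add_lt_add_iff_left (X.del s a)).mpr hsum) hδ
  rw [symbolGenFun] at hx1
  linarith

end PFA

theorem AnalyticAt.not_isPole_inv {g : ℂ → ℂ} {w : ℂ} (hg : AnalyticAt ℂ g w) (h : g w ≠ 0) :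
    ¬ IsPole g⁻¹ w :=
  fun hp => not_lt_of_ge (hg.inv h).meromorphicOrderAt_nonneg hp.2

theorem AnalyticAt.isPole_inv {g : ℂ → ℂ} {w : ℂ} (hg : AnalyticAt ℂ g w) (h : g w = 0)
    (h' : ¬ ∀ᶠ z in 𝓝 w, g z = 0) : IsPole g⁻¹ w := by
  refine ⟨hg.meromorphicAt.inv, ?_⟩
  rw [meromorphicOrderAt_inv, hg.meromorphicOrderAt_eq]
  have h0 : analyticOrderAt g w ≠ 0 := fun h0 => hg.analyticOrderAt_eq_zero.mp h0 h
  have ht : analyticOrderAt g w ≠ ⊤ := fun ht => h' (analyticOrderAt_eq_top.mp ht)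
  obtain ⟨m, hm⟩ := ENat.ne_top_iff_exists.mp ht
  rw [← hm] at h0 ⊢
  have hm0 : 0 < m := Nat.pos_of_ne_zero fun h => h0 (by rw [h]; rfl)
  change ((-(m : ℤ) : ℤ) : WithTop ℤ) < ((0 : ℤ) : WithTop ℤ)
  exact WithTop.coe_lt_coe.mpr (by omega)

/-! ### Error term and conclusion -/

theorem tendsto_sq_mul_inv_pow_ceil_logb {z ε : ℝ} (hz : 1 < z) (hε : 0 < ε) (C : ℝ)
    (hC : 0 ≤ C) :
    Tendsto (fun n : ℕ =>
      (n : ℝ) ^ 2 * (z⁻¹ ^ ((2 * ⌈(1 + ε) * Real.logb z n⌉).toNat + 1) * C)) atTop (𝓝 0) := by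
  have hz0 : 0 < z := by linarith
  have hlim : Tendsto (fun n : ℕ => (n : ℝ) ^ (-(2 * ε)) * C) atTop (𝓝 0) := by
    have := ((tendsto_rpow_neg_atTop (by linarith : 0 < 2 * ε)).comp
      tendsto_natCast_atTop_atTop).mul_const C
    simpa using this
  refine squeeze_zero' (Eventually.of_forall fun n => by positivity) ?_ hlim
  filter_upwards [eventually_ge_atTop 1] with n hn
  have hn0 : (0 : ℝ) < n := by exact_mod_cast hn
  set K := (2 * ⌈(1 + ε) * Real.logb z n⌉).toNat with hK
  have hKge : 2 * (1 + ε) * Real.logb z n ≤ K := by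
    have h1 : (1 + ε) * Real.logb z n ≤ ⌈(1 + ε) * Real.logb z n⌉ := Int.le_ceil _
    have h2 : ((2 * ⌈(1 + ε) * Real.logb z n⌉ : ℤ) : ℝ) ≤ ((K : ℤ) : ℝ) := by
      exact_mod_cast Int.self_le_toNat _
    push_cast at h2
    linarith
  have hpow : z⁻¹ ^ (K + 1) ≤ (n : ℝ) ^ (-(2 * (1 + ε))) :=
    calc z⁻¹ ^ (K + 1) ≤ z⁻¹ ^ K :=
          pow_le_pow_of_le_one (by positivity) (inv_le_one_of_one_le₀ hz.le) (Nat.le_succ K)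
      _ = z ^ (-(K : ℝ)) := by rw [Real.rpow_neg hz0.le, Real.rpow_natCast, inv_pow]
      _ ≤ z ^ (Real.logb z n * (-(2 * (1 + ε)))) :=
          Real.rpow_le_rpow_of_exponent_le hz.le (by linarith)
      _ = (n : ℝ) ^ (-(2 * (1 + ε))) := by
          rw [Real.rpow_mul hz0.le, Real.rpow_logb hz0 hz.ne' hn0]
  calc (n : ℝ) ^ 2 * (z⁻¹ ^ (K + 1) * C)
      ≤ (n : ℝ) ^ 2 * ((n : ℝ) ^ (-(2 * (1 + ε))) * C) := by gcongr
    _ = (n : ℝ) ^ (-(2 * ε)) * C := by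
        rw [← mul_assoc, ← Real.rpow_natCast, ← Real.rpow_add hn0]
        congr 2
        push_cast
        ring

theorem theorem2 {α R W : Type*} [Fintype α] [Fintype R] [Fintype W]
    (X : PFA α R W) (hX : X.IsStarLike) (s : R) (hcan : X.IsCanonical s)
    (hdel : ∀ a : α, X.del s a < 1)
    (hcond : ∀ a b : α, X.condTerm s a b < 1)
    (δ : ℝ) (hδ : IsGreatest (Set.range fun ab : α × α => X.condTerm s ab.1 ab.2) δ) :
    ∃ zt : ℝ, 1 < zt ∧ IsPole (X.genFun s δ) (zt : ℂ) ∧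
      (∀ w : ℂ, IsPole (X.genFun s δ) w → w ≠ (zt : ℂ) → zt < ‖w‖) ∧
      ∀ γ : ℝ, γ = 1 / zt →
        ∃ N : ℕ, ∀ ε : ℝ, 0 < ε → ∃ f : ℕ → ℝ, Tendsto f atTop (𝓝 0) ∧
          ∀ n : ℕ, N ≤ n →
            smoothedTrieHeight Set.univ n X.perturbation ≠ ∞ ∧
            (smoothedTrieHeight Set.univ n X.perturbation).toReal ≤
              2 * (⌈(1 + ε) * Real.logb (1 / γ) (n : ℝ)⌉ : ℝ) + f n := by
  obtain ⟨⟨⟨a₀, b₀⟩, hab⟩, hub⟩ := hδ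
  have hδle : ∀ a b, X.condTerm s a b ≤ δ := fun a b => hub ⟨(a, b), rfl⟩
  have hδ1 : δ < 1 := hab ▸ hcond a₀ b₀
  have hδ0 : 0 < δ := hX.pos_of_condTerm_le (hdel a₀) (hδle a₀)
  have : Nonempty α := ⟨a₀⟩
  obtain ⟨z, hz1, hconv, hle, a, ha⟩ := hX.exists_min_symbolGenFun_eq_one hdel hδ0 hδ1
  have hz0 : 0 < z := by linarith
  have han : ∀ w : ℂ, ‖w‖ ≤ z → AnalyticAt ℂ (fun w => ∏ a, X.genFunFactor s δ a w) w :=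
    fun w hw => Finset.analyticAt_fun_prod _ fun a _ => hX.analyticAt_genFunFactor (hconv a) hw
  have hne : ∀ w : ℂ, ‖w‖ ≤ z → w ≠ z → ∏ a, X.genFunFactor s δ a w ≠ 0 := fun w hw hwz =>
    Finset.prod_ne_zero_iff.mpr fun a _ =>
      hX.genFunFactor_ne_zero hδ0 (hdel a) (hconv a) (hle a) hw hwz
  have hnorm : ‖(z : ℂ)‖ ≤ z := by rw [Complex.norm_real, Real.norm_of_nonneg hz0.le]
  refine ⟨z, hz1, ?_, ?_, ?_⟩
  · rw [X.genFun_eq_inv]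
    refine (han z hnorm).isPole_inv (Finset.prod_eq_zero (Finset.mem_univ a) ?_) fun h => ?_
    · rw [PFA.genFunFactor_ofReal, ha, sub_self, Complex.ofReal_zero]
    -- The zero is isolated because the product does not vanish at real points just left of z.
    · have h1 : ∀ᶠ y : ℝ in 𝓝[<] z, ∏ a, X.genFunFactor s δ a (y : ℂ) = 0 :=
        (Complex.continuous_ofReal.continuousAt.eventually h).filter_mono nhdsWithin_le_nhds
      obtain ⟨y, hy, hy0, hyz⟩ := (h1.and (Ioo_mem_nhdsLT hz0)).exists
      refine hne y ?_ ?_ hy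
      · rw [Complex.norm_real, Real.norm_of_nonneg hy0.le]
        exact hyz.le
      · exact_mod_cast hyz.ne
  · intro w hw hwz
    by_contra! h
    rw [X.genFun_eq_inv] at hw
    exact (han w h).not_isPole_inv (hne w h hwz) hw
  rintro γ rfl
  rw [one_div_one_div]
  have hr0 : 0 ≤ z⁻¹ := (inv_pos.mpr hz0).le
  have hr1 : z⁻¹ < 1 := inv_lt_one_of_one_lt₀ hz1
  have henergy : ∀ (t : ℕ → α) (k : ℕ),
      wordSum k (fun v => X.outputPrefixProb t s v ^ 2) ≤ z⁻¹ ^ k := by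
    intro t k
    have hden : ∀ q, (1 - X.eta s q) * z < 1 → 0 < 1 - (1 - X.eta s q) * z := fun q h => by
      linarith
    refine le_of_tendsto (tendsto_wordSum k fun u => (X.tendsto_prefixProb t s u).pow 2)
      (Eventually.of_forall fun n => ?_)
    -- This y solves the recursion at output states with equality, and y ≥ 1 amounts to z ≥ 1.
    refine (hX.wordSum_prefixProb_sq_le t (x := z) (δ := δ)
      (y := fun q => X.eta s q * z / (1 - (1 - X.eta s q) * z))
      (good := fun q => (1 - X.eta s q) * z < 1) hz0 hδ0.le hδle hconv (fun q hq => ?_)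
      (fun q hq => ?_) (fun a => hle a) n).1 0 k
    · rw [one_le_div (hden q hq)]
      linarith
    · have := (hden q hq).ne'
      refine le_of_eq ((eq_div_iff this).mpr ?_)
      linear_combination z * (1 - X.eta s q) * div_mul_cancel₀ (X.eta s q * z) this
  have hH := fun (n K : ℕ) => smoothedTrieHeight_le Set.univ n X.perturbation hr0 hr1
    (fun A t t' htt k => X.measure_le_lcp_le hcan htt fun t => henergy t k) K
  -- From n = 1 on the logarithm is nonnegative, so `toNat` loses nothing in K. Finiteness needs
  -- only the bound with K = 0.
  refine ⟨1, fun ε hε => ⟨_, tendsto_sq_mul_inv_pow_ceil_logb hz1 hε (1 - z⁻¹)⁻¹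
    (inv_nonneg.mpr (by linarith)), fun n hn => ⟨ne_top_of_le_ne_top ENNReal.ofReal_ne_top (hH n 0),
      ?_⟩⟩⟩
  set K := (2 * ⌈(1 + ε) * Real.logb z n⌉).toNat with hK
  have hlog : 0 ≤ Real.logb z n := Real.logb_nonneg hz1 (by exact_mod_cast hn)
  have hceil : 0 ≤ ⌈(1 + ε) * Real.logb z n⌉ := Int.ceil_nonneg (by positivity)
  have hKeq : (2 * ⌈(1 + ε) * Real.logb z n⌉ : ℝ) = K := by
    have : ((2 * ⌈(1 + ε) * Real.logb z n⌉ : ℤ) : ℝ) = ((K : ℤ) : ℝ) := by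
      rw [hK, Int.toNat_of_nonneg (by omega)]
    exact_mod_cast this
  rw [hKeq]
  refine ENNReal.toReal_le_of_le_ofReal ?_ (hH n K)
  have : 0 ≤ (1 - z⁻¹)⁻¹ := inv_nonneg.mpr (by linarith)
  positivity
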